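/- Label the vertices of a nondegenerate tetrahedron in $\mathbb{R}^3$ by $V_1,V_2,V_3,V_4$, and let $\theta_{ij}\in(0,\pi)$ be the (interior) dihedral angle at the edge $V_iV_j$. Consider the following eleven sextuples $(n_{12},n_{13},n_{14},n_{23},n_{24},n_{34})$: $$\begin{array}{lll} (3,6,6,8,8,4), & (4,4,4,6,6,8), & (4,4,8,8,4,6),\\ (4,5,6,10,5,4), & (4,6,6,6,6,4), & (3,4,5,10,6,6),\\ (3,5,5,10,10,4), & (3,5,10,10,6,4), & (3,6,10,10,10,3),\\ (4,4,4,5,6,10), & (4,5,6,5,6,5). & \end{array}$$ 1. For each of these sextuples there is a tetrahedron with $\theta_{ij}=2\pi/n_{ij}$ for all $1\le i<j\le 4$, and any two such labelled tetrahedra are similar (that is, corresponding edge lengths are proportional; reflections are allowed). 2. For every tetrahedron, the following are equivalent: (a) each of its six dihedral angles has the form $2\pi/n$ with a positive integer $n$; (b) there is exactly one of the eleven sextuples $(n_{ij})$ for which, after some permutation of the labels of the vertices, $\theta_{ij}=2\pi/n_{ij}$ for all $1\le i<j\le 4$. So, up to similarity (reflections included) and permutation of the vertices, there are exactly eleven tetrahedra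 all of whose dihedral angles have the form $2\pi/n$, namely those given by these sextuples. -/

import Mathlib

noncomputable section

namespace TwoPiTetrahedra

/-- Euclidean 3-space. -/
abbrev Space : Type := EuclideanSpace ℝ (Fin 3)

/-- A (nondegenerate) tetrahedron with labelled vertices `V₁ = T.points 0`, …,
`V₄ = T.points 3`, which are affinely independent. -/
abbrev Tetrahedron : Type := Affine.Simplex ℝ Space 3

/-- The angle along the line `AB` between the half-planes that are bounded by this line and
contain `C` and `D`: the angle, in `[0, π]`, between the components of `C - A` and `D - A`
orthogonal to `B - A`. -/
def dihedral (A B C D : Space) : ℝ :=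
  InnerProductGeometry.angle
    ((ℝ ∙ (B - A))ᗮ.starProjection (C - A))
    ((ℝ ∙ (B - A))ᗮ.starProjection (D - A))

/-- The six dihedral angles `(θ₁₂, θ₁₃, θ₁₄, θ₂₃, θ₂₄, θ₃₄)` of a tetrahedron, where `θᵢⱼ` is
the angle at the edge `VᵢVⱼ` between the two faces that contain this edge. -/
def dihedralAngles (T : Tetrahedron) : Fin 6 → ℝ :=
  ![dihedral (T.points 0) (T.points 1) (T.points 2) (T.points 3),
    dihedral (T.points 0) (T.points 2) (T.points 1) (T.points 3),
    dihedral (T.points 0) (T.points 3) (T.points 1) (T.points 2),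
    dihedral (T.points 1) (T.points 2) (T.points 0) (T.points 3),
    dihedral (T.points 1) (T.points 3) (T.points 0) (T.points 2),
    dihedral (T.points 2) (T.points 3) (T.points 0) (T.points 1)]

/-- The eleven sextuples `(n₁₂, n₁₃, n₁₄, n₂₃, n₂₄, n₃₄)`. -/
def table : Fin 11 → Fin 6 → ℕ :=
  ![![3, 6, 6, 8, 8, 4],
    ![4, 4, 4, 6, 6, 8],
    ![4, 4, 8, 8, 4, 6],
    ![4, 5, 6, 10, 5, 4],
    ![4, 6, 6, 6, 6, 4],
    ![3, 4, 5, 10, 6, 6],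
    ![3, 5, 5, 10, 10, 4],
    ![3, 5, 10, 10, 6, 4],
    ![3, 6, 10, 10, 10, 3],
    ![4, 4, 4, 5, 6, 10],
    ![4, 5, 6, 5, 6, 5]]

/-- The dihedral angles of `T`, with its given labelling, are `θᵢⱼ = 2π / nᵢⱼ` for the
sextuple in row `r` of the table. -/
def HasRow (T : Tetrahedron) (r : Fin 11) : Prop :=
  ∀ e : Fin 6, dihedralAngles T e = 2 * Real.pi / (table r e : ℝ)

end TwoPiTetrahedra

end

noncomputable section

namespace TwoPiTetrahedra

open InnerProductGeometry

/-! ### Dihedral angles and relabelling -/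

/-! Let `a` be the vector of face areas. The outward unit normals have pairwise inner products `-cos
θ`, and weighted by the areas they sum to zero. So the 4×4 Gram matrix with ones on the diagonal and
`-cos θ` off it annihilates the positive vector `a`, while its four principal 3×3 minors, one per
vertex, are positive (`exists_isAreaVector`). Hence its determinant `normalDet` vanishes, its kernel
is the line through `a`, and by Cramer's rule the cofactors are positive.

The angles therefore determine the areas up to scale. The edge vectors at a vertex form, up to
scale, the basis reciprocal to the normals there, so the angles determine the shape
(`similar_of_dihedralAngles_eq`). Conversely, vanishing determinant, one positive minor, `c 0 ^ 2 <
1` and positive cofactors suffice to rebuild a tetrahedron from the kernel vector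
(`exists_tetrahedron`). The table is realized by checking this exactly in `√2` and `√5`.

For the classification, positive minors mean that the three angles at each vertex are those of a
spherical triangle, which is a system of integer inequalities in the `n`s
(`triangleOK_of_minor_pos`). If some `n` is at least 42, these force the two other angles at each
end of that edge to be supplementary, of type (3,6), (4,4) or (6,3); the determinant then factors
and is nonzero (`small_of_normalDet_eq_zero`). So every `n` lies between 3 and 41, and a search with
certified decimal cosines leaves only relabelled rows of the table (`search`, `survivors_row`). The
search only has to exclude: exactness of the survivors comes from the realization. The sum of the
cubes of the `n`s is invariant under relabelling and separates the rows. -/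

theorem dihedral_comm_right (A B C D : Space) : dihedral A B C D = dihedral A B D C :=
  angle_comm _ _

theorem dihedral_comm_left (A B C D : Space) : dihedral A B C D = dihedral B A C D := by
  have hs : (ℝ ∙ (B - A)) = (ℝ ∙ (A - B)) := by
    rw [← neg_sub A B, ← Set.neg_singleton, Submodule.span_neg]
  -- The projection kills `B - A`, so moving the base point along the edge changes nothing.
  have key : ∀ X : Space, (ℝ ∙ (B - A))ᗮ.starProjection (X - A) =
      (ℝ ∙ (A - B))ᗮ.starProjection (X - B) := by
    intro X
    have h0 := Submodule.starProjection_orthogonalComplement_singleton_eq_zero (𝕜 := ℝ) (B - A)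
    have hX : X - A = (X - B) + (B - A) := by abel
    rw [hX, map_add, h0, add_zero]
    simp only [hs]
  simp only [dihedral, key]

/-- The inner product `⟪B - A, C - A⟫`. -/
def dot (A B C : Space) : ℝ := inner ℝ (B - A) (C - A)

/-- The product of the areas of the faces `ABC`, `ABD` is related to the cosine of the dihedral
angle at `AB` by inner products. -/
theorem cos_dihedral_mul_sqrt {A B C D : Space} (hb : 0 < dot A B B)
    (hc : 0 < dot A B B * dot A C C - dot A B C ^ 2)
    (hd : 0 < dot A B B * dot A D D - dot A B D ^ 2) :
    √(dot A B B * dot A C C - dot A B C ^ 2) * √(dot A B B * dot A D D - dot A B D ^ 2) *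
      Real.cos (dihedral A B C D) = dot A B B * dot A C D - dot A B C * dot A B D := by
  have hb0 : B - A ≠ 0 := by
    intro h; simp [dot, h] at hb
  have proj : ∀ X : Space, (ℝ ∙ (B - A))ᗮ.starProjection (X - A) =
      (X - A) - (dot A B X / dot A B B) • (B - A) := by
    intro X
    rw [Submodule.starProjection_orthogonal_val, Submodule.starProjection_singleton]
    simp [dot]
  have hin : ∀ X Y : Space, inner ℝ ((X - A) - (dot A B X / dot A B B) • (B - A))
      ((Y - A) - (dot A B Y / dot A B B) • (B - A)) =
      (dot A B B * dot A X Y - dot A B X * dot A B Y) / dot A B B := by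
    intro X Y
    have hcomm : inner ℝ (X - A) (B - A) = dot A B X := real_inner_comm _ _
    have hb' : inner ℝ (B - A) (B - A) = dot A B B := rfl
    have hY : inner ℝ (B - A) (Y - A) = dot A B Y := rfl
    have hXY : inner ℝ (X - A) (Y - A) = dot A X Y := rfl
    rw [inner_sub_left, inner_sub_right (X - A), inner_sub_right ((_ : ℝ) • _),
      real_inner_smul_left, real_inner_smul_right, real_inner_smul_left, real_inner_smul_right,
      hcomm, hb', hY, hXY]
    field_simp
    ring
  have hn : ∀ X : Space, ‖(X - A) - (dot A B X / dot A B B) • (B - A)‖ =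
      √(dot A B B * dot A X X - dot A B X ^ 2) / √(dot A B B) := by
    intro X
    rw [norm_eq_sqrt_real_inner, hin, ← pow_two, Real.sqrt_div' _ hb.le]
  rw [dihedral, cos_angle, proj, proj, hin, hn, hn]
  have h1 := Real.sqrt_pos.2 hb
  have h2 := Real.sqrt_pos.2 hc
  have h3 := Real.sqrt_pos.2 hd
  have h4 := Real.sq_sqrt hb.le
  field_simp
  rw [h4]
  field_simp

/-- The number, in the order `12, 13, 14, 23, 24, 34`, of the edge with given vertices. -/
def edgeIdx : Fin 4 → Fin 4 → Fin 6 :=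
  ![![0, 0, 1, 2], ![0, 0, 3, 4], ![1, 3, 0, 5], ![2, 4, 5, 0]]

def edgeFst : Fin 6 → Fin 4 := ![0, 0, 0, 1, 1, 2]
def edgeSnd : Fin 6 → Fin 4 := ![1, 2, 3, 2, 3, 3]
/-- The vertices that are not on a given edge. -/
def coedgeFst : Fin 6 → Fin 4 := ![2, 1, 1, 0, 0, 0]
def coedgeSnd : Fin 6 → Fin 4 := ![3, 3, 2, 3, 2, 1]

/-- The action of a permutation of the vertices on the edges. -/
def edgeMap (σ : Equiv.Perm (Fin 4)) (e : Fin 6) : Fin 6 :=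
  edgeIdx (σ (edgeFst e)) (σ (edgeSnd e))

theorem dihedralAngles_eq (T : Tetrahedron) (e : Fin 6) :
    dihedralAngles T e = dihedral (T.points (edgeFst e)) (T.points (edgeSnd e))
      (T.points (coedgeFst e)) (T.points (coedgeSnd e)) := by
  fin_cases e <;> rfl

theorem dihedral_eq_of_eq_or_swap {i j k l i' j' k' l' : Fin 4} (p : Fin 4 → Space)
    (h : (i = i' ∧ j = j' ∨ i = j' ∧ j = i') ∧ (k = k' ∧ l = l' ∨ k = l' ∧ l = k')) :
    dihedral (p i) (p j) (p k) (p l) = dihedral (p i') (p j') (p k') (p l') := by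
  obtain ⟨⟨rfl, rfl⟩ | ⟨rfl, rfl⟩, ⟨rfl, rfl⟩ | ⟨rfl, rfl⟩⟩ := h
  · rfl
  · exact dihedral_comm_right _ _ _ _
  · exact dihedral_comm_left _ _ _ _
  · rw [dihedral_comm_left, dihedral_comm_right]

theorem dihedralAngles_reindex (T : Tetrahedron) (σ : Equiv.Perm (Fin 4)) (e : Fin 6) :
    dihedralAngles (T.reindex σ) e = dihedralAngles T (edgeMap σ.symm e) := by
  rw [dihedralAngles_eq, dihedralAngles_eq]
  simp only [Affine.Simplex.reindex_points, Function.comp_apply]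
  apply dihedral_eq_of_eq_or_swap
  generalize σ.symm = τ
  revert τ e
  decide +kernel

theorem edgeMap_symm (σ : Equiv.Perm (Fin 4)) (e : Fin 6) :
    edgeMap σ (edgeMap σ.symm e) = e := by
  revert σ e
  decide +kernel

theorem edgeMap_bijective (σ : Equiv.Perm (Fin 4)) : Function.Bijective (edgeMap σ) :=
  (Function.bijective_iff_has_inverse).2
    ⟨edgeMap σ.symm, fun e => edgeMap_symm σ.symm e, edgeMap_symm σ⟩

/-! ### The relation between dihedral angles and areas of faces -/

/-- The determinant of the Gram matrix of three unit normals. -/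
def minor (x y z : ℝ) : ℝ := 1 - x ^ 2 - y ^ 2 - z ^ 2 - 2 * x * y * z

/-- `a` is proportional to the areas of the faces (indexed by the opposite vertex) of a tetrahedron
whose dihedral angles have cosines `c`. -/
structure IsAreaVector (c : Fin 6 → ℝ) (a : Fin 4 → ℝ) : Prop where
  pos : ∀ k, 0 < a k
  eq0 : a 0 = a 1 * c 5 + a 2 * c 4 + a 3 * c 3
  eq1 : a 1 = a 0 * c 5 + a 2 * c 2 + a 3 * c 1
  eq2 : a 2 = a 0 * c 4 + a 1 * c 2 + a 3 * c 0
  eq3 : a 3 = a 0 * c 3 + a 1 * c 1 + a 2 * c 0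
  minor0 : 0 < minor (c 0) (c 1) (c 2)
  minor1 : 0 < minor (c 0) (c 3) (c 4)
  minor2 : 0 < minor (c 1) (c 3) (c 5)
  minor3 : 0 < minor (c 2) (c 4) (c 5)

/-- Four times the squared area of a triangle. -/
def areaSq (A B C : Space) : ℝ := dot A B B * dot A C C - dot A B C ^ 2

theorem dot_comm (A B C : Space) : dot A B C = dot A C B := real_inner_comm _ _

theorem dot_change_base (A B C D : Space) :
    dot B C D = dot A C D - dot A B C - dot A B D + dot A B B := by
  have h : ∀ X : Space, X - B = (X - A) - (B - A) := fun X => by abel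
  have hCB : inner ℝ (C - A) (B - A) = dot A B C := real_inner_comm _ _
  rw [dot, h C, h D]
  rw [inner_sub_left, inner_sub_right (C - A), inner_sub_right (B - A), hCB]
  change dot A C D - dot A B C - (dot A B D - dot A B B) = _
  ring

theorem dot_self_left (A B : Space) : dot A A B = 0 := by simp [dot]

theorem areaSq_comm_right (A B C : Space) : areaSq A B C = areaSq A C B := by
  rw [areaSq, areaSq, dot_comm A B C]; ring

theorem areaSq_comm_left (A B C : Space) : areaSq A B C = areaSq B A C := by
  rw [areaSq, areaSq, dot_change_base A B A A, dot_change_base A B C C, dot_change_base A B A C]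
  simp only [dot_comm A B A, dot_self_left]; ring

theorem areaSq_rotate (A B C : Space) : areaSq A B C = areaSq B C A := by
  rw [areaSq_comm_left, areaSq_comm_right]

theorem cos_dihedral_mul_area {A B C D : Space} (hc : 0 < areaSq A B C) (hd : 0 < areaSq A B D) :
    √(areaSq A B C) * √(areaSq A B D) * Real.cos (dihedral A B C D) =
      dot A B B * dot A C D - dot A B C * dot A B D := by
  refine cos_dihedral_mul_sqrt ?_ hc hd
  have h1 : 0 ≤ dot A B B := real_inner_self_nonneg
  refine lt_of_le_of_ne h1 fun h => ?_
  rw [areaSq, ← h] at hc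
  nlinarith [sq_nonneg (dot A B C)]

theorem areaSq_pos {T : Tetrahedron} {i j k : Fin 4} (hij : j ≠ i) (hik : k ≠ i) (hjk : j ≠ k) :
    0 < areaSq (T.points i) (T.points j) (T.points k) := by
  have h := (affineIndependent_iff_linearIndependent_vsub ℝ T.points i).1 T.independent
  have h2 := h.comp (![⟨j, hij⟩, ⟨k, hik⟩] : Fin 2 → {x // x ≠ i}) (by
    intro a b; fin_cases a <;> fin_cases b <;> simp [hjk, hjk.symm])
  have h3 := (Matrix.posDef_gram_of_linearIndependent (𝕜 := ℝ) h2).det_pos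
  rw [Matrix.det_fin_two] at h3
  simp only [Matrix.gram_apply, Function.comp_apply, Matrix.cons_val_zero, Matrix.cons_val_one,
    vsub_eq_sub] at h3
  rw [real_inner_comm (T.points j - T.points i) (T.points k - T.points i)] at h3
  rw [areaSq, pow_two]
  exact h3

/-- The Gram determinant of three vectors. -/
def gramDet (uu vv ww uv uw vw : ℝ) : ℝ :=
  uu * vv * ww + 2 * uv * uw * vw - uu * vw ^ 2 - vv * uw ^ 2 - ww * uv ^ 2

/-- The Gram determinant of the edge vectors of a tetrahedron at its first vertex. -/
def volSq (T : Tetrahedron) : ℝ :=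
  gramDet (dot (T.points 0) (T.points 1) (T.points 1)) (dot (T.points 0) (T.points 2) (T.points 2))
    (dot (T.points 0) (T.points 3) (T.points 3)) (dot (T.points 0) (T.points 1) (T.points 2))
    (dot (T.points 0) (T.points 1) (T.points 3)) (dot (T.points 0) (T.points 2) (T.points 3))

theorem volSq_pos (T : Tetrahedron) : 0 < volSq T := by
  have h := (affineIndependent_iff_linearIndependent_vsub ℝ T.points 0).1 T.independent
  have h2 := h.comp (![⟨1, by decide⟩, ⟨2, by decide⟩, ⟨3, by decide⟩] :
      Fin 3 → {x : Fin 4 // x ≠ 0}) (by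
    intro a b; fin_cases a <;> fin_cases b <;> simp)
  have h3 := (Matrix.posDef_gram_of_linearIndependent (𝕜 := ℝ) h2).det_pos
  rw [Matrix.det_fin_three] at h3
  simp only [Matrix.gram_apply, Function.comp_apply, Matrix.cons_val_zero, Matrix.cons_val_one,
    vsub_eq_sub, Matrix.cons_val] at h3
  have e (i j : Fin 4) : inner ℝ (T.points i - T.points 0) (T.points j - T.points 0) =
    dot (T.points 0) (T.points i) (T.points j) := rfl
  simp only [e, dot_comm _ (T.points 2) (T.points 1), dot_comm _ (T.points 3) (T.points 1),
    dot_comm _ (T.points 3) (T.points 2)] at h3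
  rw [volSq, gramDet]
  linarith

theorem pos_of_mul_sq_eq_sq {m b d : ℝ} (hd : 0 < d) (h : m * b ^ 2 = d ^ 2) : 0 < m := by
  by_contra hm
  nlinarith [sq_nonneg b, pow_pos hd 2, mul_nonneg (neg_nonneg.2 (not_lt.1 hm)) (sq_nonneg b)]

theorem minor_mul {p q r x y z : ℝ} : minor x y z * (p * q * r) ^ 2 =
    p ^ 2 * q ^ 2 * r ^ 2 - p ^ 2 * (q * r * x) ^ 2 - q ^ 2 * (p * r * y) ^ 2
      - r ^ 2 * (p * q * z) ^ 2 - 2 * (q * r * x) * (p * r * y) * (p * q * z) := by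
  rw [minor]; ring

/-- The vector consists of twice the face areas. Besides the area relations, the conclusion records
the data at the first vertex from which its Gram matrix is recovered in `volSq_mul_dot`. -/
theorem exists_isAreaVector (T : Tetrahedron) : ∃ a : Fin 4 → ℝ,
    IsAreaVector (fun e => Real.cos (dihedralAngles T e)) a ∧
    a 1 ^ 2 = areaSq (T.points 0) (T.points 2) (T.points 3) ∧
    a 2 ^ 2 = areaSq (T.points 0) (T.points 1) (T.points 3) ∧
    a 3 ^ 2 = areaSq (T.points 0) (T.points 1) (T.points 2) ∧
    a 2 * a 3 * Real.cos (dihedralAngles T 0) =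
      dot (T.points 0) (T.points 1) (T.points 1) * dot (T.points 0) (T.points 2) (T.points 3) -
      dot (T.points 0) (T.points 1) (T.points 2) * dot (T.points 0) (T.points 1) (T.points 3) ∧
    a 1 * a 3 * Real.cos (dihedralAngles T 1) =
      dot (T.points 0) (T.points 2) (T.points 2) * dot (T.points 0) (T.points 1) (T.points 3) -
      dot (T.points 0) (T.points 1) (T.points 2) * dot (T.points 0) (T.points 2) (T.points 3) ∧
    a 1 * a 2 * Real.cos (dihedralAngles T 2) =
      dot (T.points 0) (T.points 3) (T.points 3) * dot (T.points 0) (T.points 1) (T.points 2) -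
      dot (T.points 0) (T.points 1) (T.points 3) * dot (T.points 0) (T.points 2) (T.points 3) := by
  have hD := volSq_pos T
  have p0 := areaSq_pos (T := T) (i := 1) (j := 2) (k := 3) (by decide) (by decide) (by decide)
  have p1 := areaSq_pos (T := T) (i := 0) (j := 2) (k := 3) (by decide) (by decide) (by decide)
  have p2 := areaSq_pos (T := T) (i := 0) (j := 1) (k := 3) (by decide) (by decide) (by decide)
  have p3 := areaSq_pos (T := T) (i := 0) (j := 1) (k := 2) (by decide) (by decide) (by decide)
  have d0 : dihedralAngles T 0 = dihedral (T.points 0) (T.points 1) (T.points 2) (T.points 3) := rfl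
  have d1 : dihedralAngles T 1 = dihedral (T.points 0) (T.points 2) (T.points 1) (T.points 3) := rfl
  have d2 : dihedralAngles T 2 = dihedral (T.points 0) (T.points 3) (T.points 1) (T.points 2) := rfl
  have d3 : dihedralAngles T 3 = dihedral (T.points 1) (T.points 2) (T.points 0) (T.points 3) := rfl
  have d4 : dihedralAngles T 4 = dihedral (T.points 1) (T.points 3) (T.points 0) (T.points 2) := rfl
  have d5 : dihedralAngles T 5 = dihedral (T.points 2) (T.points 3) (T.points 0) (T.points 1) := rfl
  rw [volSq] at hD
  rw [d0, d1, d2]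
  generalize T.points 0 = P0 at *
  generalize T.points 1 = P1 at *
  generalize T.points 2 = P2 at *
  generalize T.points 3 = P3 at *
  have s0 := Real.sq_sqrt p0.le
  have s1 := Real.sq_sqrt p1.le
  have s2 := Real.sq_sqrt p2.le
  have s3 := Real.sq_sqrt p3.le
  have h0 := cos_dihedral_mul_area p3 p2
  have h1 := cos_dihedral_mul_area (C := P1) (areaSq_comm_right P0 P1 P2 ▸ p3) p1
  have h2 := cos_dihedral_mul_area (areaSq_comm_right P0 P1 P3 ▸ p2) (areaSq_comm_right P0 P2 P3 ▸ p1)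
  have h3 := cos_dihedral_mul_area (areaSq_rotate P0 P1 P2 ▸ p3) p0
  have h4 := cos_dihedral_mul_area (areaSq_rotate P0 P1 P3 ▸ p2) (areaSq_comm_right P1 P2 P3 ▸ p0)
  have h5 := cos_dihedral_mul_area (areaSq_rotate P0 P2 P3 ▸ p1) (areaSq_rotate P1 P2 P3 ▸ p0)
  rw [areaSq_comm_right P0 P2 P1] at h1
  rw [areaSq_comm_right P0 P3 P1, areaSq_comm_right P0 P3 P2] at h2
  rw [← areaSq_rotate P0 P1 P2] at h3
  rw [← areaSq_rotate P0 P1 P3, areaSq_comm_right P1 P3 P2] at h4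
  rw [← areaSq_rotate P0 P2 P3, ← areaSq_rotate P1 P2 P3] at h5
  rw [← d0] at h0 ⊢
  rw [← d1] at h1 ⊢
  rw [← d2] at h2 ⊢
  rw [← d3] at h3
  rw [← d4] at h4
  rw [← d5] at h5
  clear d0 d1 d2 d3 d4 d5
  have q0 := Real.sqrt_pos.2 p0
  have q1 := Real.sqrt_pos.2 p1
  have q2 := Real.sqrt_pos.2 p2
  have q3 := Real.sqrt_pos.2 p3
  generalize √(areaSq P1 P2 P3) = a0 at *
  generalize √(areaSq P0 P2 P3) = a1 at *
  generalize √(areaSq P0 P1 P3) = a2 at *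
  generalize √(areaSq P0 P1 P2) = a3 at *
  refine ⟨![a0, a1, a2, a3], ?_, s1, s2, s3, ?_, ?_, ?_⟩
  · simp only [areaSq] at s0 s1 s2 s3
    simp only [dot_change_base P0 P1, dot_change_base P0 P2, dot_comm P0 _ P0, dot_self_left,
      dot_comm P0 P2 P1, dot_comm P0 P3 P1, dot_comm P0 P3 P2] at s0 s1 s2 s3 h0 h1 h2 h3 h4 h5
    rw [gramDet] at hD
    generalize dot P0 P1 P1 = uu at *
    generalize dot P0 P2 P2 = vv at *
    generalize dot P0 P3 P3 = ww at *
    generalize dot P0 P1 P2 = uv at *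
    generalize dot P0 P1 P3 = uw at *
    generalize dot P0 P2 P3 = vw at *
    have h0' : a2 * a3 * _ = _ := (congrArg (· * _) (mul_comm a2 a3)).trans h0
    have h1' : a1 * a3 * _ = _ := (congrArg (· * _) (mul_comm a1 a3)).trans h1
    have h2' : a1 * a2 * _ = _ := (congrArg (· * _) (mul_comm a1 a2)).trans h2
    have h3' : a0 * a3 * _ = _ := (congrArg (· * _) (mul_comm a0 a3)).trans h3
    have h4' : a0 * a2 * _ = _ := (congrArg (· * _) (mul_comm a0 a2)).trans h4
    have h5' : a0 * a1 * _ = _ := (congrArg (· * _) (mul_comm a0 a1)).trans h5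
    constructor
    · intro k
      fin_cases k <;> assumption
    · change a0 = a1 * _ + a2 * _ + a3 * _
      -- Multiplied by `a0`, the relation becomes a linear identity between `a0 ^ 2` and the
      -- products `a0 * aⱼ * cos`, all of which are polynomials in the edge inner products.
      apply mul_left_cancel₀ q0.ne'
      linear_combination s0 - h5 - h4 - h3
    · change a1 = a0 * _ + a2 * _ + a3 * _
      apply mul_left_cancel₀ q1.ne'
      linear_combination s1 - h5 - h2 - h1
    · change a2 = a0 * _ + a1 * _ + a3 * _
      apply mul_left_cancel₀ q2.ne'
      linear_combination s2 - h4 - h2 - h0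
    · change a3 = a0 * _ + a1 * _ + a2 * _
      apply mul_left_cancel₀ q3.ne'
      linear_combination s3 - h3 - h1 - h0
    -- The Gram determinant of the three area vectors is the square of the Gram determinant of the
    -- edge vectors.
    · refine pos_of_mul_sq_eq_sq hD (b := a1 * a2 * a3) ?_
      rw [minor_mul, h0', h1', h2', s1, s2, s3]; ring
    · refine pos_of_mul_sq_eq_sq hD (b := a0 * a2 * a3) ?_
      rw [minor_mul, h0', h3', h4', s0, s2, s3]; ring
    · refine pos_of_mul_sq_eq_sq hD (b := a0 * a1 * a3) ?_
      rw [minor_mul, h1', h3', h5', s0, s1, s3]; ring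
    · refine pos_of_mul_sq_eq_sq hD (b := a0 * a1 * a2) ?_
      rw [minor_mul, h2', h4', h5', s0, s1, s2]; ring
  · change a2 * a3 * _ = _
    rw [mul_comm a2, h0]
  · change a1 * a3 * _ = _
    rw [mul_comm a1, h1, dot_comm P0 P2 P1]
  · change a1 * a2 * _ = _
    rw [mul_comm a1, h2, dot_comm P0 P3 P1, dot_comm P0 P3 P2]

/-! ### Uniqueness up to similarity -/

/-- Off-diagonal cofactors of the Gram matrix of the unit normals. -/
def cof1 (c : Fin 6 → ℝ) : ℝ :=
  (1 - c 0 ^ 2) * c 5 + (c 2 + c 0 * c 1) * c 4 + (c 1 + c 0 * c 2) * c 3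
def cof2 (c : Fin 6 → ℝ) : ℝ :=
  (c 2 + c 0 * c 1) * c 5 + (1 - c 1 ^ 2) * c 4 + (c 0 + c 1 * c 2) * c 3
def cof3 (c : Fin 6 → ℝ) : ℝ :=
  (c 1 + c 0 * c 2) * c 5 + (c 0 + c 1 * c 2) * c 4 + (1 - c 2 ^ 2) * c 3

/-- The determinant of the Gram matrix of the unit normals. -/
def normalDet (c : Fin 6 → ℝ) : ℝ :=
  minor (c 0) (c 1) (c 2) - c 5 * cof1 c - c 4 * cof2 c - c 3 * cof3 c

namespace IsAreaVector

variable {c : Fin 6 → ℝ} {a : Fin 4 → ℝ}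

/-- Cramer's rule: `eq1`, `eq2`, `eq3` form a linear system for `a 1, a 2, a 3` with right-hand side
`a 0 * (c 5, c 4, c 3)`, and `cof1`, `cof2`, `cof3` are the adjugate applied to `(c 5, c 4, c 3)`.
-/
theorem minor_mul_one (h : IsAreaVector c a) :
    minor (c 0) (c 1) (c 2) * a 1 = cof1 c * a 0 := by
  rw [minor, cof1]
  linear_combination (1 - c 0 ^ 2) * h.eq1 + (c 2 + c 0 * c 1) * h.eq2 + (c 1 + c 0 * c 2) * h.eq3

theorem minor_mul_two (h : IsAreaVector c a) :
    minor (c 0) (c 1) (c 2) * a 2 = cof2 c * a 0 := by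
  rw [minor, cof2]
  linear_combination (c 2 + c 0 * c 1) * h.eq1 + (1 - c 1 ^ 2) * h.eq2 + (c 0 + c 1 * c 2) * h.eq3

theorem minor_mul_three (h : IsAreaVector c a) :
    minor (c 0) (c 1) (c 2) * a 3 = cof3 c * a 0 := by
  rw [minor, cof3]
  linear_combination (c 1 + c 0 * c 2) * h.eq1 + (c 0 + c 1 * c 2) * h.eq2 + (1 - c 2 ^ 2) * h.eq3

theorem cof_pos (h : IsAreaVector c a) : 0 < cof1 c ∧ 0 < cof2 c ∧ 0 < cof3 c := by
  have h0 := h.pos 0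
  have aux {p q : ℝ} (hp : 0 < p) (e : minor (c 0) (c 1) (c 2) * p = q * a 0) : 0 < q :=
    pos_of_mul_pos_left (e ▸ mul_pos h.minor0 hp) h0.le
  exact ⟨aux (h.pos 1) h.minor_mul_one, aux (h.pos 2) h.minor_mul_two,
    aux (h.pos 3) h.minor_mul_three⟩

theorem normalDet_eq_zero (h : IsAreaVector c a) : normalDet c = 0 := by
  apply mul_right_cancel₀ (h.pos 0).ne'
  rw [normalDet]
  linear_combination minor (c 0) (c 1) (c 2) * h.eq0 + c 5 * h.minor_mul_one +
    c 4 * h.minor_mul_two + c 3 * h.minor_mul_three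

theorem eq_smul {a' : Fin 4 → ℝ} (h : IsAreaVector c a) (h' : IsAreaVector c a') (k : Fin 4) :
    a k = a 0 / a' 0 * a' k := by
  have h0 := (h'.pos 0).ne'
  have aux {p p' q : ℝ} (e : minor (c 0) (c 1) (c 2) * p = q * a 0)
      (e' : minor (c 0) (c 1) (c 2) * p' = q * a' 0) : p = a 0 / a' 0 * p' := by
    have hm := h.minor0.ne'
    rw [div_mul_eq_mul_div, eq_div_iff h0]
    apply mul_left_cancel₀ hm
    linear_combination a' 0 * e - a 0 * e'
  fin_cases k
  · change a 0 = a 0 / a' 0 * a' 0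
    field_simp
  · exact aux h.minor_mul_one h'.minor_mul_one
  · exact aux h.minor_mul_two h'.minor_mul_two
  · exact aux h.minor_mul_three h'.minor_mul_three

end IsAreaVector

/-- The cross product of two area vectors of faces through the first vertex is, up to sign, the
square root of `volSq T` times their common edge vector. The entries are the inner products of such
cross products, by the Binet–Cauchy identity. -/
theorem volSq_mul_dot (T : Tetrahedron) {c : Fin 6 → ℝ}
    (hc : ∀ e, Real.cos (dihedralAngles T e) = c e) : ∃ a : Fin 4 → ℝ, IsAreaVector c a ∧
    ∀ i j, volSq T * dot (T.points 0) (T.points i) (T.points j) =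
      (![![0, 0, 0, 0],
         ![0, a 2 ^ 2 * a 3 ^ 2 * (1 - c 0 ^ 2), a 1 * a 2 * a 3 ^ 2 * (c 2 + c 0 * c 1),
           a 1 * a 2 ^ 2 * a 3 * (c 1 + c 0 * c 2)],
         ![0, a 1 * a 2 * a 3 ^ 2 * (c 2 + c 0 * c 1), a 1 ^ 2 * a 3 ^ 2 * (1 - c 1 ^ 2),
           a 1 ^ 2 * a 2 * a 3 * (c 0 + c 1 * c 2)],
         ![0, a 1 * a 2 ^ 2 * a 3 * (c 1 + c 0 * c 2), a 1 ^ 2 * a 2 * a 3 * (c 0 + c 1 * c 2),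
           a 1 ^ 2 * a 2 ^ 2 * (1 - c 2 ^ 2)]] : Fin 4 → Fin 4 → ℝ) i j := by
  obtain ⟨a, ha, h1, h2, h3, e0, e1, e2⟩ := exists_isAreaVector T
  simp only [hc] at ha e0 e1 e2
  refine ⟨a, ha, ?_⟩
  have e11 : volSq T * dot (T.points 0) (T.points 1) (T.points 1) =
      a 2 ^ 2 * a 3 ^ 2 * (1 - c 0 ^ 2) := by
    have : a 2 ^ 2 * a 3 ^ 2 * (1 - c 0 ^ 2) = a 2 ^ 2 * a 3 ^ 2 - (a 2 * a 3 * c 0) ^ 2 := by ring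
    rw [this, e0, h2, h3, volSq, gramDet, areaSq, areaSq]; ring
  have e22 : volSq T * dot (T.points 0) (T.points 2) (T.points 2) =
      a 1 ^ 2 * a 3 ^ 2 * (1 - c 1 ^ 2) := by
    have : a 1 ^ 2 * a 3 ^ 2 * (1 - c 1 ^ 2) = a 1 ^ 2 * a 3 ^ 2 - (a 1 * a 3 * c 1) ^ 2 := by ring
    rw [this, e1, h1, h3, volSq, gramDet, areaSq, areaSq]; ring
  have e33 : volSq T * dot (T.points 0) (T.points 3) (T.points 3) =
      a 1 ^ 2 * a 2 ^ 2 * (1 - c 2 ^ 2) := by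
    have : a 1 ^ 2 * a 2 ^ 2 * (1 - c 2 ^ 2) = a 1 ^ 2 * a 2 ^ 2 - (a 1 * a 2 * c 2) ^ 2 := by ring
    rw [this, e2, h1, h2, volSq, gramDet, areaSq, areaSq]; ring
  have e12 : volSq T * dot (T.points 0) (T.points 1) (T.points 2) =
      a 1 * a 2 * a 3 ^ 2 * (c 2 + c 0 * c 1) := by
    have : a 1 * a 2 * a 3 ^ 2 * (c 2 + c 0 * c 1) =
      a 3 ^ 2 * (a 1 * a 2 * c 2) + (a 2 * a 3 * c 0) * (a 1 * a 3 * c 1) := by ring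
    rw [this, e0, e1, e2, h3, volSq, gramDet, areaSq]; ring
  have e13 : volSq T * dot (T.points 0) (T.points 1) (T.points 3) =
      a 1 * a 2 ^ 2 * a 3 * (c 1 + c 0 * c 2) := by
    have : a 1 * a 2 ^ 2 * a 3 * (c 1 + c 0 * c 2) =
      a 2 ^ 2 * (a 1 * a 3 * c 1) + (a 2 * a 3 * c 0) * (a 1 * a 2 * c 2) := by ring
    rw [this, e0, e1, e2, h2, volSq, gramDet, areaSq]; ring
  have e23 : volSq T * dot (T.points 0) (T.points 2) (T.points 3) =
      a 1 ^ 2 * a 2 * a 3 * (c 0 + c 1 * c 2) := by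
    have : a 1 ^ 2 * a 2 * a 3 * (c 0 + c 1 * c 2) =
      a 1 ^ 2 * (a 2 * a 3 * c 0) + (a 1 * a 3 * c 1) * (a 1 * a 2 * c 2) := by ring
    rw [this, e0, e1, e2, h1, volSq, gramDet, areaSq]; ring
  have z (X : Space) : dot (T.points 0) (T.points 0) X = 0 := dot_self_left _ _
  intro i j
  fin_cases i <;> fin_cases j
  all_goals first
    | exact e11 | exact e22 | exact e33 | exact e12 | exact e13 | exact e23
    | (refine (congrArg _ (dot_comm _ _ _)).trans ?_
       first | exact e12 | exact e13 | exact e23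
             | exact (congrArg _ (z _)).trans (mul_zero _))
    | exact (congrArg _ (z _)).trans (mul_zero _)

theorem dist_sq_eq (A B C : Space) :
    dist B C ^ 2 = dot A B B + dot A C C - 2 * dot A B C := by
  rw [dist_comm, dist_eq_norm, ← real_inner_self_eq_norm_sq]
  change dot B C C = _
  rw [dot_change_base A]; ring

theorem similar_of_dihedralAngles_eq {T T' : Tetrahedron}
    (h : ∀ e, dihedralAngles T e = dihedralAngles T' e) : Similar T.points T'.points := by
  obtain ⟨a, ha, hT⟩ := volSq_mul_dot T (c := fun e => Real.cos (dihedralAngles T' e))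
    (fun e => by rw [h])
  obtain ⟨a', ha', hT'⟩ := volSq_mul_dot T' (fun e => rfl)
  have hV := volSq_pos T
  have hV' := volSq_pos T'
  have hk : 0 < a 0 / a' 0 := div_pos (ha.pos 0) (ha'.pos 0)
  have hs := ha.eq_smul ha'
  -- The formulas of `volSq_mul_dot` are homogeneous of degree 4 in the areas, hence the fourth
  -- power of the ratio.
  have hdot : ∀ i j, dot (T.points 0) (T.points i) (T.points j) =
      ((a 0 / a' 0) ^ 4 * volSq T' / volSq T) * dot (T'.points 0) (T'.points i) (T'.points j) := by
    intro i j
    apply mul_left_cancel₀ hV.ne'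
    rw [← mul_assoc, mul_div_cancel₀ _ hV.ne', mul_assoc, hT, hT', hs 1, hs 2, hs 3]
    generalize a 0 / a' 0 = κ
    fin_cases i <;> fin_cases j <;>
      simp only [Fin.zero_eta, Fin.mk_one, Fin.reduceFinMk, Matrix.cons_val_zero,
        Matrix.cons_val_one, Matrix.cons_val] <;> ring
  have hr : 0 < (a 0 / a' 0) ^ 4 * volSq T' / volSq T := by positivity
  generalize (a 0 / a' 0) ^ 4 * volSq T' / volSq T = ρ at hdot hr
  refine similar_iff_exists_pos_dist_eq.2 ⟨√ρ, Real.sqrt_pos.2 hr, fun i j => ?_⟩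
  rw [← sq_eq_sq₀ dist_nonneg (by positivity), mul_pow, Real.sq_sqrt hr.le,
    dist_sq_eq (T.points 0), dist_sq_eq (T'.points 0), hdot, hdot, hdot]
  ring

/-! ### Existence -/

theorem exists_gram {uu vv ww uv uw vw : ℝ} (h1 : 0 < uu) (h2 : 0 < uu * vv - uv ^ 2)
    (h3 : 0 < gramDet uu vv ww uv uw vw) : ∃ T : Tetrahedron,
      dot (T.points 0) (T.points 1) (T.points 1) = uu ∧
      dot (T.points 0) (T.points 2) (T.points 2) = vv ∧
      dot (T.points 0) (T.points 3) (T.points 3) = ww ∧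
      dot (T.points 0) (T.points 1) (T.points 2) = uv ∧
      dot (T.points 0) (T.points 1) (T.points 3) = uw ∧
      dot (T.points 0) (T.points 2) (T.points 3) = vw := by
  -- Cholesky factorization: the edge vectors are sought as `(p, 0, 0)`, `(q, r, 0)`, `(s, t, z)`.
  obtain ⟨p, hp, hp2⟩ : ∃ p : ℝ, 0 < p ∧ p ^ 2 = uu := ⟨√uu, Real.sqrt_pos.2 h1, Real.sq_sqrt h1.le⟩
  obtain ⟨q, hq⟩ : ∃ q, p * q = uv := ⟨uv / p, by field_simp⟩
  obtain ⟨s, hs⟩ : ∃ s, p * s = uw := ⟨uw / p, by field_simp⟩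
  have hr0 : 0 < vv - q ^ 2 := by
    have : 0 < p ^ 2 * (vv - q ^ 2) := by rw [mul_sub, ← mul_pow, hq, hp2]; exact h2
    exact pos_of_mul_pos_right this (by positivity)
  obtain ⟨r, hr, hr2⟩ : ∃ r : ℝ, 0 < r ∧ r ^ 2 = vv - q ^ 2 :=
    ⟨√(vv - q ^ 2), Real.sqrt_pos.2 hr0, Real.sq_sqrt hr0.le⟩
  obtain ⟨t, ht⟩ : ∃ t, r * t = vw - q * s := ⟨(vw - q * s) / r, by field_simp⟩
  have hz0 : 0 < ww - s ^ 2 - t ^ 2 := by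
    have : 0 < (p * r) ^ 2 * (ww - s ^ 2 - t ^ 2) := by
      have hvv : vv = r ^ 2 + q ^ 2 := by linarith
      have hvw : vw = r * t + q * s := by linarith
      rw [← hp2, ← hq, ← hs, hvv, hvw, gramDet] at h3
      linarith
    exact pos_of_mul_pos_right this (by positivity)
  obtain ⟨z, hz, hz2⟩ : ∃ z : ℝ, 0 < z ∧ z ^ 2 = ww - s ^ 2 - t ^ 2 :=
    ⟨√(ww - s ^ 2 - t ^ 2), Real.sqrt_pos.2 hz0, Real.sq_sqrt hz0.le⟩
  have hind : AffineIndependent ℝ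
      ![(0 : Space), !₂[p, 0, 0], !₂[q, r, 0], !₂[s, t, z]] := by
    rw [affineIndependent_iff_linearIndependent_vsub ℝ _ (0 : Fin 4),
      ← linearIndependent_equiv (finSuccAboveEquiv (0 : Fin 4)), Fintype.linearIndependent_iff]
    intro g hg
    simp only [Fin.sum_univ_three, Function.comp_apply] at hg
    have e0 := congrArg (fun x : Space => x 0) hg
    have e1 := congrArg (fun x : Space => x 1) hg
    have e2 := congrArg (fun x : Space => x 2) hg
    simp [finSuccAboveEquiv_apply, Fin.succAbove, hz.ne'] at e0 e1 e2
    have g2 : g 2 = 0 := e2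
    rw [g2] at e0 e1
    simp [hr.ne'] at e1
    rw [e1] at e0
    simp [hp.ne'] at e0
    intro i
    fin_cases i <;> assumption
  refine ⟨⟨_, hind⟩, ?_⟩
  simp [dot, PiLp.inner_apply, Fin.sum_univ_three, EuclideanSpace.real_norm_sq_eq]
  refine ⟨?_, ?_, ?_, ?_, ?_, ?_⟩ <;> linarith

theorem exists_tetrahedron {c : Fin 6 → ℝ} (hc0 : c 0 ^ 2 < 1)
    (hm : 0 < minor (c 0) (c 1) (c 2)) (h1 : 0 < cof1 c) (h2 : 0 < cof2 c) (h3 : 0 < cof3 c)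
    (hdet : normalDet c = 0) :
    ∃ T : Tetrahedron, ∀ e, Real.cos (dihedralAngles T e) = c e := by
  obtain ⟨a, ha0, ha1, ha2, ha3⟩ : ∃ a : Fin 4 → ℝ, a 0 = minor (c 0) (c 1) (c 2) ∧
    a 1 = cof1 c ∧ a 2 = cof2 c ∧ a 3 = cof3 c := ⟨![_, _, _, _], rfl, rfl, rfl, rfl⟩
  rw [← ha0] at hm
  rw [← ha1] at h1
  rw [← ha2] at h2
  rw [← ha3] at h3
  have q0 : a 0 = a 1 * c 5 + a 2 * c 4 + a 3 * c 3 := by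
    rw [ha0, ha1, ha2, ha3]; rw [normalDet] at hdet; linarith
  have q1 : a 1 = a 0 * c 5 + a 2 * c 2 + a 3 * c 1 := by
    rw [ha0, ha1, ha2, ha3, minor, cof1, cof2, cof3]; ring
  have q2 : a 2 = a 0 * c 4 + a 1 * c 2 + a 3 * c 0 := by
    rw [ha0, ha1, ha2, ha3, minor, cof1, cof2, cof3]; ring
  have q3 : a 3 = a 0 * c 3 + a 1 * c 1 + a 2 * c 0 := by
    rw [ha0, ha1, ha2, ha3, minor, cof1, cof2, cof3]; ring
  rw [minor] at ha0
  have hc0' : 0 < 1 - c 0 ^ 2 := by linarith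
  -- The prescribed Gram matrix is the right-hand side of `volSq_mul_dot` for the kernel vector `a`;
  -- the missing volume factor only affects the scale.
  obtain ⟨T, t11, t22, t33, t12, t13, t23⟩ := exists_gram
    (uu := a 2 ^ 2 * a 3 ^ 2 * (1 - c 0 ^ 2)) (vv := a 1 ^ 2 * a 3 ^ 2 * (1 - c 1 ^ 2))
    (ww := a 1 ^ 2 * a 2 ^ 2 * (1 - c 2 ^ 2)) (uv := a 1 * a 2 * a 3 ^ 2 * (c 2 + c 0 * c 1))
    (uw := a 1 * a 2 ^ 2 * a 3 * (c 1 + c 0 * c 2)) (vw := a 1 ^ 2 * a 2 * a 3 * (c 0 + c 1 * c 2))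
    (by positivity)
    (by
      have : 0 < a 1 ^ 2 * a 2 ^ 2 * a 3 ^ 4 * a 0 := by positivity
      rw [ha0] at this
      linarith)
    (by
      have : 0 < (a 1 * a 2 * a 3) ^ 4 * a 0 ^ 2 := by positivity
      rw [ha0] at this
      rw [gramDet]
      linarith)
  obtain ⟨b, hb, b1, b2, b3, e0, e1, e2⟩ := exists_isAreaVector T
  simp only [areaSq, t11, t22, t33, t12, t13, t23] at b1 b2 b3 e0 e1 e2
  obtain ⟨d, hd⟩ : ∃ d : Fin 6 → ℝ, ∀ e, Real.cos (dihedralAngles T e) = d e := ⟨_, fun _ => rfl⟩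
  simp only [hd] at hb e0 e1 e2
  obtain ⟨κ, hκ, hκ2⟩ : ∃ κ : ℝ, 0 < κ ∧ κ ^ 2 = (a 1 * a 2 * a 3) ^ 2 * a 0 :=
    ⟨√((a 1 * a 2 * a 3) ^ 2 * a 0), Real.sqrt_pos.2 (by positivity), Real.sq_sqrt (by positivity)⟩
  have hb1 : b 1 = κ * a 1 := by
    rw [← sq_eq_sq₀ (hb.pos 1).le (by positivity), b1, mul_pow κ, hκ2, ha0]; ring
  have hb2 : b 2 = κ * a 2 := by
    rw [← sq_eq_sq₀ (hb.pos 2).le (by positivity), b2, mul_pow κ, hκ2, ha0]; ring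
  have hb3 : b 3 = κ * a 3 := by
    rw [← sq_eq_sq₀ (hb.pos 3).le (by positivity), b3, mul_pow κ, hκ2, ha0]; ring
  have f0 : d 0 = c 0 := by
    apply mul_left_cancel₀ (mul_pos (hb.pos 2) (hb.pos 3)).ne'
    rw [e0, hb2, hb3]
    linear_combination (-(a 2 * a 3 * c 0)) * hκ2 -
      a 2 * a 3 * c 0 * (a 1 * a 2 * a 3) ^ 2 * ha0
  have f1 : d 1 = c 1 := by
    apply mul_left_cancel₀ (mul_pos (hb.pos 1) (hb.pos 3)).ne'
    rw [e1, hb1, hb3]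
    linear_combination (-(a 1 * a 3 * c 1)) * hκ2 -
      a 1 * a 3 * c 1 * (a 1 * a 2 * a 3) ^ 2 * ha0
  have f2 : d 2 = c 2 := by
    apply mul_left_cancel₀ (mul_pos (hb.pos 1) (hb.pos 2)).ne'
    rw [e2, hb1, hb2]
    linear_combination (-(a 1 * a 2 * c 2)) * hκ2 -
      a 1 * a 2 * c 2 * (a 1 * a 2 * a 3) ^ 2 * ha0
  have r0 := hb.eq0
  have r1 := hb.eq1
  have r2 := hb.eq2
  have r3 := hb.eq3
  rw [f1, f2, hb1, hb2, hb3] at r1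
  rw [f0, f2, hb1, hb2, hb3] at r2
  rw [f0, f1, hb1, hb2, hb3] at r3
  rw [hb1, hb2, hb3] at r0
  -- Eliminating the cosines at the edges of face 0 expresses `b 0 ^ 2` through the other areas and
  -- the angles at the first vertex, which already agree.
  have hb0 : b 0 = κ * a 0 := by
    rw [← sq_eq_sq₀ (hb.pos 0).le (by positivity)]
    linear_combination b 0 * r0 - κ * a 1 * r1 - κ * a 2 * r2 - κ * a 3 * r3 +
      κ ^ 2 * (a 1 * q1 + a 2 * q2 + a 3 * q3 - a 0 * q0)
  have hne : κ * a 0 ≠ 0 := (mul_pos hκ hm).ne'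
  rw [hb0] at r1 r2 r3
  have f3 : d 3 = c 3 := mul_left_cancel₀ hne (by linear_combination κ * q3 - r3)
  have f4 : d 4 = c 4 := mul_left_cancel₀ hne (by linear_combination κ * q2 - r2)
  have f5 : d 5 = c 5 := mul_left_cancel₀ hne (by linear_combination κ * q1 - r1)
  refine ⟨T, fun e => (hd e).trans ?_⟩
  fin_cases e
  exacts [f0, f1, f2, f3, f4, f5]

/-! ### Approximations of cosines -/

theorem sum_exp_series_re (y : ℝ) (N : ℕ) :
    (∑ m ∈ Finset.range (2 * N), ((y : ℂ) * Complex.I) ^ m / (m.factorial : ℂ)).re =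
      ∑ k ∈ Finset.range N, (-1) ^ k * y ^ (2 * k) / ((2 * k).factorial : ℝ) := by
  induction N with
  | zero => simp
  | succ N ih =>
    rw [show 2 * (N + 1) = 2 * N + 1 + 1 by ring, Finset.sum_range_succ, Finset.sum_range_succ,
      Finset.sum_range_succ, Complex.add_re, Complex.add_re, ih]
    have h : ((y : ℂ) * Complex.I) ^ (2 * N) = (((-1) ^ N * y ^ (2 * N) : ℝ) : ℂ) := by
      rw [mul_pow, pow_mul Complex.I, Complex.I_sq]; push_cast; ring
    have h1 : (((y : ℂ) * Complex.I) ^ (2 * N) / ((2 * N).factorial : ℂ)).re =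
        (-1) ^ N * y ^ (2 * N) / ((2 * N).factorial : ℝ) := by
      rw [h, ← Complex.ofReal_natCast, ← Complex.ofReal_div, Complex.ofReal_re]
    have h2 : (((y : ℂ) * Complex.I) ^ (2 * N + 1) / ((2 * N + 1).factorial : ℂ)).re = 0 := by
      have : ((y : ℂ) * Complex.I) ^ (2 * N + 1) / ((2 * N + 1).factorial : ℂ) =
          (((-1) ^ N * y ^ (2 * N) * y / ((2 * N + 1).factorial : ℝ) : ℝ) : ℂ) * Complex.I := by
        rw [pow_succ, h]; push_cast; ring
      rw [this, Complex.re_ofReal_mul, Complex.I_re, mul_zero]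
    rw [h1, h2, add_zero]

/-- Real part of the bound `Complex.exp_bound'` at `y * I` and order `2 * N`; `|y| ≤ N` implies its
condition `|y| / (2 * N + 1) ≤ 1 / 2`. -/
theorem abs_cos_sub_taylor_le {y : ℝ} (N : ℕ) (hy : |y| ≤ N) :
    |Real.cos y - ∑ k ∈ Finset.range N, (-1) ^ k * y ^ (2 * k) / ((2 * k).factorial : ℝ)| ≤
      |y| ^ (2 * N) / ((2 * N).factorial : ℝ) * 2 := by
  have hn : ‖(y : ℂ) * Complex.I‖ = |y| := by simp
  have h := Complex.exp_bound' (x := (y : ℂ) * Complex.I) (n := 2 * N) (by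
    rw [hn, div_le_iff₀ (by positivity)]; push_cast; linarith)
  rw [hn] at h
  refine le_trans ?_ h
  refine le_trans (le_of_eq ?_) (Complex.abs_re_le_norm _)
  rw [Complex.sub_re, sum_exp_series_re, Complex.exp_ofReal_mul_I_re]

/-- Pairs of `n` and the integer nearest to `10 ^ 10 * cos (2 * π / n)`. -/
def cosTable : List (ℕ × ℤ) :=
  [(3, -5000000000), (4, 0), (5, 3090169944), (6, 5000000000), (7, 6234898019), (8, 7071067812),
    (9, 7660444431), (10, 8090169944), (11, 8412535328), (12, 8660254038), (13, 8854560257),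
    (14, 9009688679), (15, 9135454576), (16, 9238795325), (17, 9324722294), (18, 9396926208),
    (19, 9458172417), (20, 9510565163), (21, 9555728058), (22, 9594929736), (23, 9629172873),
    (24, 9659258263), (25, 9685831611), (26, 9709418174), (27, 9730448706), (28, 9749279122),
    (29, 9766205557), (30, 9781476007), (31, 9795299413), (32, 9807852804), (33, 9819286973),
    (34, 9829730997), (35, 9839295886), (36, 9848077530), (37, 9856159103), (38, 9863613034),
    (39, 9870502626), (40, 9876883406), (41, 9882804238)]

/-- A Taylor polynomial of the cosine at a rational point. -/
def cosTaylor (y : ℚ) : ℚ :=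
  ∑ k ∈ Finset.range 16, (-1) ^ k * y ^ (2 * k) / ((2 * k).factorial : ℚ)

theorem cosTaylor_cosTable : ∀ p ∈ cosTable, 3 ≤ p.1 ∧ |p.2| ≤ 10 ^ 10 ∧
    |cosTaylor (2 * 3.14159265358979323846 / p.1) - p.2 / 10 ^ 10| ≤ 6 / 10 ^ 11 := by
  decide +kernel

theorem abs_cos_sub_cosTable_le {p : ℕ × ℤ} (hp : p ∈ cosTable) :
    |Real.cos (2 * Real.pi / p.1) - p.2 / 10 ^ 10| ≤ 1 / 10 ^ 10 := by
  obtain ⟨h3, -, h⟩ := cosTaylor_cosTable p hp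
  have h3' : (3 : ℝ) ≤ p.1 := by exact_mod_cast h3
  have hR : |((cosTaylor (2 * 3.14159265358979323846 / p.1) : ℚ) : ℝ) - p.2 / 10 ^ 10| ≤
      6 / 10 ^ 11 := by
    have := (Rat.cast_le (K := ℝ)).2 h
    push_cast at this
    exact this
  set y : ℝ := 2 * 3.14159265358979323846 / p.1 with hy
  have hy0 : 0 ≤ y := by positivity
  have hy3 : y ≤ 3 := by
    rw [hy, div_le_iff₀ (by positivity)]; norm_num; linarith
  have hc : ((cosTaylor (2 * 3.14159265358979323846 / p.1) : ℚ) : ℝ) =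
      ∑ k ∈ Finset.range 16, (-1) ^ k * y ^ (2 * k) / ((2 * k).factorial : ℝ) := by
    rw [cosTaylor, hy]; push_cast; rfl
  rw [hc] at hR
  have hT := abs_cos_sub_taylor_le (y := y) 16 (by rw [abs_of_nonneg hy0]; norm_num; linarith)
  have hE : |y| ^ (2 * 16) / ((2 * 16).factorial : ℝ) * 2 ≤ 2 / 10 ^ 11 := by
    rw [abs_of_nonneg hy0]
    have : y ^ (2 * 16) ≤ 3 ^ (2 * 16) := by gcongr
    have hf : ((2 * 16).factorial : ℝ) = 263130836933693530167218012160000000 := by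
      norm_num [Nat.factorial]
    rw [hf]
    norm_num at this ⊢
    linarith
  have hpi : |Real.cos (2 * Real.pi / p.1) - Real.cos y| ≤ 1 / 10 ^ 11 := by
    refine (Real.abs_cos_sub_cos_le _ _).trans ?_
    have e : 2 * Real.pi / p.1 - y = 2 * (Real.pi - 3.14159265358979323846) / p.1 := by
      rw [hy]; ring
    have l1 := Real.pi_gt_d20
    have l2 := Real.pi_lt_d20
    rw [e, abs_of_nonneg (div_nonneg (by linarith) (by positivity)), div_le_iff₀ (by positivity)]
    norm_num at l1 l2 ⊢
    linarith
  -- Error budget in units of `10 ^ (-11)`: 6 for rounding, 2 for the Taylor remainder, 1 for the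
  -- decimal value of π, within the allowed 10.
  rw [abs_le] at *
  constructor <;> linarith [hR.1, hR.2, hT.1, hT.2, hpi.1, hpi.2, hE]

theorem exists_mem_cosTable {n : ℕ} (h3 : 3 ≤ n) (h41 : n ≤ 41) : ∃ p ∈ cosTable, p.1 = n := by
  have : ∀ n ∈ Finset.Icc 3 41, ∃ p ∈ cosTable, p.1 = n := by decide +kernel
  exact this n (Finset.mem_Icc.2 ⟨h3, h41⟩)

theorem abs_mul_sub_mul_le {p q x y K L : ℝ} (h : |p - q| ≤ K) (h' : |x - y| ≤ L) (hp : |p| ≤ 1)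
    (hy : |y| ≤ 1) : |p * x - q * y| ≤ K + L := by
  have e : p * x - q * y = (p - q) * y + p * (x - y) := by ring
  rw [e]
  refine (abs_add_le _ _).trans (add_le_add ?_ ?_)
  · rw [abs_mul]; exact (mul_le_of_le_one_right (abs_nonneg _) hy).trans h
  · rw [abs_mul]; exact (mul_le_of_le_one_left (abs_nonneg _) hp).trans h'

theorem abs_mul_le_one {p q : ℝ} (hp : |p| ≤ 1) (hq : |q| ≤ 1) : |p * q| ≤ 1 := by
  rw [abs_mul]; exact mul_le_one₀ hp (abs_nonneg _) hq

theorem abs_monomial_two_sub_le {c x : Fin 6 → ℝ} {ε : ℝ} (hc : ∀ e, |c e| ≤ 1)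
    (hx : ∀ e, |x e| ≤ 1) (h : ∀ e, |c e - x e| ≤ ε) (i j : Fin 6) :
    |c i * c j - x i * x j| ≤ ε + ε :=
  abs_mul_sub_mul_le (h i) (h j) (hc i) (hx j)

theorem abs_monomial_three_sub_le {c x : Fin 6 → ℝ} {ε : ℝ} (hc : ∀ e, |c e| ≤ 1)
    (hx : ∀ e, |x e| ≤ 1) (h : ∀ e, |c e - x e| ≤ ε) (i j k : Fin 6) :
    |c i * c j * c k - x i * x j * x k| ≤ ε + ε + ε :=
  abs_mul_sub_mul_le (abs_monomial_two_sub_le hc hx h i j) (h k)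
    (abs_mul_le_one (hc i) (hc j)) (hx k)

theorem abs_monomial_four_sub_le {c x : Fin 6 → ℝ} {ε : ℝ} (hc : ∀ e, |c e| ≤ 1)
    (hx : ∀ e, |x e| ≤ 1) (h : ∀ e, |c e - x e| ≤ ε) (i j k l : Fin 6) :
    |c i * c j * (c k * c l) - x i * x j * (x k * x l)| ≤ ε + ε + (ε + ε) :=
  abs_mul_sub_mul_le (abs_monomial_two_sub_le hc hx h i j) (abs_monomial_two_sub_le hc hx h k l)
    (abs_mul_le_one (hc i) (hc j)) (abs_mul_le_one (hx k) (hx l))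

/-- A monomial of degree `d` is perturbed by at most `d * ε`, and 14 = 1 + 2 + 2 + 3 + 3 + 3. One
side suffices, since only positivity of the exact cofactor is transferred. -/
theorem cof1_sub_le {c x : Fin 6 → ℝ} {ε : ℝ} (hc : ∀ e, |c e| ≤ 1)
    (hx : ∀ e, |x e| ≤ 1) (h : ∀ e, |c e - x e| ≤ ε) : cof1 c - cof1 x ≤ 14 * ε := by
  have h3 := abs_monomial_three_sub_le hc hx h
  have h2 := abs_monomial_two_sub_le hc hx h
  simp only [abs_le] at h h2 h3
  rw [cof1, cof1]
  linarith [h 5, h3 0 0 5, h2 2 4, h3 0 1 4, h2 1 3, h3 0 2 3]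

theorem cof2_sub_le {c x : Fin 6 → ℝ} {ε : ℝ} (hc : ∀ e, |c e| ≤ 1)
    (hx : ∀ e, |x e| ≤ 1) (h : ∀ e, |c e - x e| ≤ ε) : cof2 c - cof2 x ≤ 14 * ε := by
  have h3 := abs_monomial_three_sub_le hc hx h
  have h2 := abs_monomial_two_sub_le hc hx h
  simp only [abs_le] at h h2 h3
  rw [cof2, cof2]
  linarith [h 4, h3 1 1 4, h2 2 5, h3 0 1 5, h2 0 3, h3 1 2 3]

theorem cof3_sub_le {c x : Fin 6 → ℝ} {ε : ℝ} (hc : ∀ e, |c e| ≤ 1)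
    (hx : ∀ e, |x e| ≤ 1) (h : ∀ e, |c e - x e| ≤ ε) : cof3 c - cof3 x ≤ 14 * ε := by
  have h3 := abs_monomial_three_sub_le hc hx h
  have h2 := abs_monomial_two_sub_le hc hx h
  simp only [abs_le] at h h2 h3
  rw [cof3, cof3]
  linarith [h 3, h3 2 2 3, h2 1 5, h3 0 2 5, h2 0 4, h3 1 2 4]

/-- Degrees weighted by coefficients: six squares give 12, four doubled cubic terms 24, three
quartic squares 12 and three doubled quartic terms 24, in all 72. -/
theorem abs_normalDet_sub_le {c x : Fin 6 → ℝ} {ε : ℝ} (hc : ∀ e, |c e| ≤ 1)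
    (hx : ∀ e, |x e| ≤ 1) (h : ∀ e, |c e - x e| ≤ ε) :
    |normalDet c - normalDet x| ≤ 72 * ε := by
  have h4 := abs_monomial_four_sub_le hc hx h
  have h3 := abs_monomial_three_sub_le hc hx h
  have h2 := abs_monomial_two_sub_le hc hx h
  simp only [abs_le] at h h2 h3 h4
  simp only [normalDet, minor, cof1, cof2, cof3]
  rw [abs_le]
  constructor <;>
  linarith [h2 0 0, h2 1 1, h2 2 2, h2 3 3, h2 4 4, h2 5 5, h3 0 1 2, h3 0 3 4, h3 1 3 5, h3 2 4 5,
    h4 0 0 5 5, h4 1 1 4 4, h4 2 2 3 3, h4 0 1 4 5, h4 0 2 3 5, h4 1 2 3 4]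

/-! ### The finite search -/

/-- The inequalities satisfied by the angles `2π/a, 2π/b, 2π/c` of a spherical triangle: their sum
is greater than `π`, and the sum of any two of them exceeds the third by less than `π`. -/
def triangleOK (a b c : ℕ) : Bool :=
  Nat.blt (a * b * c) (2 * (a * (b + c) + b * c)) && Nat.blt (2 * (a * (b + c))) (b * c * (a + 2)) &&
  Nat.blt (2 * (b * (a + c))) (a * c * (b + 2)) && Nat.blt (2 * (c * (a + b))) (a * b * (c + 2))

theorem triangleOK_iff {a b c : ℕ} : triangleOK a b c ↔
    ((a * b * c < 2 * (a * (b + c) + b * c) ∧ 2 * (a * (b + c)) < b * c * (a + 2)) ∧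
      2 * (b * (a + c)) < a * c * (b + 2)) ∧ 2 * (c * (a + b)) < a * b * (c + 2) := by
  simp only [triangleOK, Bool.and_eq_true, Nat.blt_eq]

/-- The integer version of `cof1`, in units of `10 ^ (-30)`. -/
def intCof1 (x0 x1 x2 x3 x4 x5 : ℤ) : ℤ :=
  (10 ^ 20 - x0 * x0) * x5 + (10 ^ 10 * x2 + x0 * x1) * x4 + (10 ^ 10 * x1 + x0 * x2) * x3
def intCof2 (x0 x1 x2 x3 x4 x5 : ℤ) : ℤ :=
  (10 ^ 10 * x2 + x0 * x1) * x5 + (10 ^ 20 - x1 * x1) * x4 + (10 ^ 10 * x0 + x1 * x2) * x3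
def intCof3 (x0 x1 x2 x3 x4 x5 : ℤ) : ℤ :=
  (10 ^ 10 * x1 + x0 * x2) * x5 + (10 ^ 10 * x0 + x1 * x2) * x4 + (10 ^ 20 - x2 * x2) * x3
/-- The integer version of `normalDet`, in units of `10 ^ (-40)`. -/
def intDet (x0 x1 x2 x3 x4 x5 : ℤ) : ℤ :=
  10 ^ 20 * (10 ^ 20 - x0 * x0 - x1 * x1 - x2 * x2) - 2 * 10 ^ 10 * (x0 * x1 * x2)
    - x5 * intCof1 x0 x1 x2 x3 x4 x5 - x4 * intCof2 x0 x1 x2 x3 x4 x5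
    - x3 * intCof3 x0 x1 x2 x3 x4 x5

/-- The sextuples that survive the search. -/
def survivors : List (Fin 6 → ℕ) :=
  [![6, 6, 4, 4, 6, 6], ![6, 6, 5, 4, 5, 5], ![8, 6, 4, 4, 4, 8], ![8, 6, 4, 6, 4, 4],
   ![8, 8, 3, 4, 6, 6], ![10, 5, 4, 4, 5, 6], ![10, 6, 3, 4, 5, 10], ![10, 6, 3, 6, 4, 5],
   ![10, 6, 4, 3, 5, 10], ![10, 6, 4, 5, 4, 4], ![10, 6, 4, 6, 3, 5], ![10, 10, 3, 3, 6, 10],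
   ![10, 10, 3, 3, 10, 6], ![10, 10, 3, 4, 5, 5]]

/-- Whether a sextuple of entries of `cosTable` may, up to rounding errors, have determinant zero and
positive cofactors. -/
def mayOccur (p0 p1 p2 p3 p4 p5 : ℕ × ℤ) : Bool :=
  decide (intDet p0.2 p1.2 p2.2 p3.2 p4.2 p5.2 ≤ 10 ^ 32) &&
  decide (-10 ^ 32 ≤ intDet p0.2 p1.2 p2.2 p3.2 p4.2 p5.2) &&
  decide (-10 ^ 22 < intCof1 p0.2 p1.2 p2.2 p3.2 p4.2 p5.2) &&
  decide (-10 ^ 22 < intCof2 p0.2 p1.2 p2.2 p3.2 p4.2 p5.2) &&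
  decide (-10 ^ 22 < intCof3 p0.2 p1.2 p2.2 p3.2 p4.2 p5.2)

/-- Each spherical triangle is tested as soon as its three entries are fixed, so that the
short-circuiting `||` prunes the enumeration. The order constraints put a largest entry at edge 0
and a largest entry among the edges meeting it at edge 1. -/
theorem search : (cosTable.all fun p0 => cosTable.all fun p1 => !Nat.ble p1.1 p0.1 ||
    cosTable.all fun p2 => !Nat.ble p2.1 p1.1 || !triangleOK p0.1 p1.1 p2.1 ||
    cosTable.all fun p3 => !Nat.ble p3.1 p1.1 ||
    cosTable.all fun p4 => !Nat.ble p4.1 p1.1 || !triangleOK p0.1 p3.1 p4.1 ||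
    cosTable.all fun p5 => !Nat.ble p5.1 p0.1 || !triangleOK p1.1 p3.1 p5.1 ||
      !triangleOK p2.1 p4.1 p5.1 || !mayOccur p0 p1 p2 p3 p4 p5 ||
      decide (![p0.1, p1.1, p2.1, p3.1, p4.1, p5.1] ∈ survivors)) = true := by
  decide +kernel

theorem mem_survivors_of_mayOccur {p0 p1 p2 p3 p4 p5 : ℕ × ℤ} (h0 : p0 ∈ cosTable)
    (h1 : p1 ∈ cosTable) (h2 : p2 ∈ cosTable) (h3 : p3 ∈ cosTable) (h4 : p4 ∈ cosTable)
    (h5 : p5 ∈ cosTable) (h10 : p1.1 ≤ p0.1) (h21 : p2.1 ≤ p1.1) (h31 : p3.1 ≤ p1.1)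
    (h41 : p4.1 ≤ p1.1) (h50 : p5.1 ≤ p0.1) (t0 : triangleOK p0.1 p1.1 p2.1)
    (t1 : triangleOK p0.1 p3.1 p4.1) (t2 : triangleOK p1.1 p3.1 p5.1)
    (t3 : triangleOK p2.1 p4.1 p5.1) (h : mayOccur p0 p1 p2 p3 p4 p5) :
    ![p0.1, p1.1, p2.1, p3.1, p4.1, p5.1] ∈ survivors := by
  have s := search
  rw [← Nat.ble_eq] at h10 h21 h31 h41 h50
  replace s := List.all_eq_true.1 (List.all_eq_true.1 s p0 h0) p1 h1
  rw [h10, Bool.not_true, Bool.false_or] at s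
  replace s := List.all_eq_true.1 s p2 h2
  rw [h21, t0, Bool.not_true, Bool.false_or, Bool.false_or] at s
  replace s := List.all_eq_true.1 s p3 h3
  rw [h31, Bool.not_true, Bool.false_or] at s
  replace s := List.all_eq_true.1 s p4 h4
  rw [h41, t1, Bool.not_true, Bool.false_or, Bool.false_or] at s
  replace s := List.all_eq_true.1 s p5 h5
  rw [h50, t2, t3, h, Bool.not_true, Bool.false_or, Bool.false_or, Bool.false_or,
    Bool.false_or] at s
  exact of_decide_eq_true s

/-- There are fourteen survivors for eleven rows because ties among the largest entries give three
rows two sorted forms each. -/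
theorem survivors_row : ∀ n ∈ survivors, ∃ r : Fin 11, ∃ σ : Equiv.Perm (Fin 4),
    ∀ e, n (edgeMap σ e) = table r e := by
  decide +kernel

theorem eq_of_sum_pow_eq : ∀ r s : Fin 11, ∑ e, table r e ^ 3 = ∑ e, table s e ^ 3 → r = s := by
  decide +kernel

theorem mem_survivors {n : Fin 6 → ℕ} (hn : ∀ e, 3 ≤ n e) (hn' : ∀ e, n e ≤ 41)
    {c : Fin 6 → ℝ} (hc : ∀ e, c e = Real.cos (2 * Real.pi / n e))
    (t0 : triangleOK (n 0) (n 1) (n 2)) (t1 : triangleOK (n 0) (n 3) (n 4))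
    (t2 : triangleOK (n 1) (n 3) (n 5)) (t3 : triangleOK (n 2) (n 4) (n 5))
    (h1 : 0 < cof1 c) (h2 : 0 < cof2 c) (h3 : 0 < cof3 c) (hdet : normalDet c = 0)
    (h10 : n 1 ≤ n 0) (h50 : n 5 ≤ n 0) (h21 : n 2 ≤ n 1) (h31 : n 3 ≤ n 1) (h41 : n 4 ≤ n 1) :
    n ∈ survivors := by
  choose p hp hpn using fun e => exists_mem_cosTable (hn e) (hn' e)
  have hx : ∀ e, |((p e).2 : ℝ) / 10 ^ 10| ≤ 1 := fun e => by
    have := (cosTaylor_cosTable _ (hp e)).2.1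
    rw [abs_div, abs_of_pos (by positivity : (0 : ℝ) < 10 ^ 10), div_le_one (by positivity)]
    exact_mod_cast this
  have hc1 : ∀ e, |c e| ≤ 1 := fun e => hc e ▸ Real.abs_cos_le_one _
  have hcx : ∀ e, |c e - (p e).2 / 10 ^ 10| ≤ 1 / 10 ^ 10 := fun e => by
    rw [hc, ← hpn]; exact abs_cos_sub_cosTable_le (hp e)
  have e1 := cof1_sub_le hc1 hx hcx
  have e2 := cof2_sub_le hc1 hx hcx
  have e3 := cof3_sub_le hc1 hx hcx
  have e4 := abs_le.1 (abs_normalDet_sub_le hc1 hx hcx)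
  have hn_eq : n = ![(p 0).1, (p 1).1, (p 2).1, (p 3).1, (p 4).1, (p 5).1] := by
    funext e; rw [← hpn e]; fin_cases e <;> rfl
  have c1 : cof1 (fun e => ((p e).2 : ℝ) / 10 ^ 10) =
      (intCof1 (p 0).2 (p 1).2 (p 2).2 (p 3).2 (p 4).2 (p 5).2 : ℝ) / 10 ^ 30 := by
    rw [cof1, intCof1]; push_cast; ring
  have c2 : cof2 (fun e => ((p e).2 : ℝ) / 10 ^ 10) =
      (intCof2 (p 0).2 (p 1).2 (p 2).2 (p 3).2 (p 4).2 (p 5).2 : ℝ) / 10 ^ 30 := by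
    rw [cof2, intCof2]; push_cast; ring
  have c3 : cof3 (fun e => ((p e).2 : ℝ) / 10 ^ 10) =
      (intCof3 (p 0).2 (p 1).2 (p 2).2 (p 3).2 (p 4).2 (p 5).2 : ℝ) / 10 ^ 30 := by
    rw [cof3, intCof3]; push_cast; ring
  have c4 : normalDet (fun e => ((p e).2 : ℝ) / 10 ^ 10) =
      (intDet (p 0).2 (p 1).2 (p 2).2 (p 3).2 (p 4).2 (p 5).2 : ℝ) / 10 ^ 40 := by
    rw [normalDet, c1, c2, c3, minor, intDet]; push_cast; ring
  rw [c1] at e1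
  rw [c2] at e2
  rw [c3] at e3
  rw [c4, hdet] at e4
  simp only [← hpn] at h10 h50 h21 h31 h41 t0 t1 t2 t3
  rw [hn_eq]
  refine mem_survivors_of_mayOccur (hp 0) (hp 1) (hp 2) (hp 3) (hp 4) (hp 5) h10 h21 h31 h41 h50
    t0 t1 t2 t3 ?_
  -- With `ε = 10 ^ (-10)`, the errors are `72 * 10 ^ 30` for the determinant and `14 * 10 ^ 20` for
  -- the cofactors in the integer units, below the thresholds `10 ^ 32` and `10 ^ 22`.
  simp only [mayOccur, Bool.and_eq_true, decide_eq_true_eq]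
  refine ⟨⟨⟨⟨?_, ?_⟩, ?_⟩, ?_⟩, ?_⟩
  · have : (intDet (p 0).2 (p 1).2 (p 2).2 (p 3).2 (p 4).2 (p 5).2 : ℝ) ≤ 10 ^ 32 := by
      norm_num at e4 ⊢; linarith
    exact_mod_cast this
  · have : -10 ^ 32 ≤ (intDet (p 0).2 (p 1).2 (p 2).2 (p 3).2 (p 4).2 (p 5).2 : ℝ) := by
      norm_num at e4 ⊢; linarith
    exact_mod_cast this
  · have : -10 ^ 22 < (intCof1 (p 0).2 (p 1).2 (p 2).2 (p 3).2 (p 4).2 (p 5).2 : ℝ) := by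
      norm_num at e1 ⊢; linarith
    exact_mod_cast this
  · have : -10 ^ 22 < (intCof2 (p 0).2 (p 1).2 (p 2).2 (p 3).2 (p 4).2 (p 5).2 : ℝ) := by
      norm_num at e2 ⊢; linarith
    exact_mod_cast this
  · have : -10 ^ 22 < (intCof3 (p 0).2 (p 1).2 (p 2).2 (p 3).2 (p 4).2 (p 5).2 : ℝ) := by
      norm_num at e3 ⊢; linarith
    exact_mod_cast this

/-! ### Spherical triangles with angles `2π/n` -/

theorem minor_cos (α β γ : ℝ) : minor (Real.cos α) (Real.cos β) (Real.cos γ) =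
    -4 * Real.cos ((α + β + γ) / 2) * Real.cos ((β + γ - α) / 2) * Real.cos ((α + γ - β) / 2) *
      Real.cos ((α + β - γ) / 2) := by
  have h1 := Real.two_mul_cos_mul_cos ((α + β + γ) / 2) ((β + γ - α) / 2)
  have h2 := Real.two_mul_cos_mul_cos ((α + γ - β) / 2) ((α + β - γ) / 2)
  rw [show (α + β + γ) / 2 - (β + γ - α) / 2 = α by ring,
    show (α + β + γ) / 2 + (β + γ - α) / 2 = β + γ by ring, Real.cos_add] at h1
  rw [show (α + γ - β) / 2 - (α + β - γ) / 2 = γ - β by ring,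
    show (α + γ - β) / 2 + (α + β - γ) / 2 = α by ring, Real.cos_sub] at h2
  have h3 := Real.sin_sq_add_cos_sq β
  have h4 := Real.sin_sq_add_cos_sq γ
  rw [minor]
  linear_combination
    (Real.cos α + (Real.cos β * Real.cos γ + Real.sin β * Real.sin γ)) * h1 +
    2 * (Real.cos ((α + β + γ) / 2) * Real.cos ((β + γ - α) / 2)) * h2
    - (1 - Real.cos β ^ 2) * h4 - Real.sin γ ^ 2 * h3

/-- If the inequality failed, the first two cosines in the factorization `minor_cos` would be
nonpositive and the last two nonnegative, making the minor nonpositive. -/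
theorem add_lt_of_minor_pos {α β γ : ℝ} (hα : 0 < α) (hβ' : β < Real.pi) (hγ' : γ < Real.pi)
    (h : 0 < minor (Real.cos α) (Real.cos β) (Real.cos γ)) : β + γ < Real.pi + α := by
  by_contra! hle
  have c1 : Real.cos ((β + γ - α) / 2) ≤ 0 :=
    Real.cos_nonpos_of_pi_div_two_le_of_le (by linarith) (by linarith)
  have c0 : Real.cos ((α + β + γ) / 2) ≤ 0 :=
    Real.cos_nonpos_of_pi_div_two_le_of_le (by linarith) (by linarith)
  have c2 : 0 ≤ Real.cos ((α + γ - β) / 2) :=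
    Real.cos_nonneg_of_neg_pi_div_two_le_of_le (by linarith) (by linarith)
  have c3 : 0 ≤ Real.cos ((α + β - γ) / 2) :=
    Real.cos_nonneg_of_neg_pi_div_two_le_of_le (by linarith) (by linarith)
  rw [minor_cos] at h
  nlinarith [mul_nonneg (mul_nonneg_of_nonpos_of_nonpos c0 c1) (mul_nonneg c2 c3)]

theorem minor_rotate (x y z : ℝ) : minor x y z = minor y z x := by rw [minor, minor]; ring

theorem pi_lt_add_of_minor_pos {α β γ : ℝ} (hα : 0 < α) (hβ : 0 < β) (hγ : 0 < γ)
    (hα' : α < Real.pi) (hβ' : β < Real.pi) (hγ' : γ < Real.pi)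
    (h : 0 < minor (Real.cos α) (Real.cos β) (Real.cos γ)) : Real.pi < α + β + γ := by
  have k1 := add_lt_of_minor_pos hα hβ' hγ' h
  have h' := h
  rw [minor_rotate] at h'
  have k2 := add_lt_of_minor_pos hβ hγ' hα' h'
  rw [minor_rotate] at h'
  have k3 := add_lt_of_minor_pos hγ hα' hβ' h'
  by_contra! hle
  have c0 : 0 ≤ Real.cos ((α + β + γ) / 2) :=
    Real.cos_nonneg_of_neg_pi_div_two_le_of_le (by linarith) (by linarith)
  have c1 : 0 ≤ Real.cos ((β + γ - α) / 2) :=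
    Real.cos_nonneg_of_neg_pi_div_two_le_of_le (by linarith) (by linarith)
  have c2 : 0 ≤ Real.cos ((α + γ - β) / 2) :=
    Real.cos_nonneg_of_neg_pi_div_two_le_of_le (by linarith) (by linarith)
  have c3 : 0 ≤ Real.cos ((α + β - γ) / 2) :=
    Real.cos_nonneg_of_neg_pi_div_two_le_of_le (by linarith) (by linarith)
  rw [minor_cos] at h
  nlinarith [mul_nonneg (mul_nonneg c0 c1) (mul_nonneg c2 c3)]

theorem two_pi_div_pos {n : ℕ} (hn : 3 ≤ n) : 0 < 2 * Real.pi / n := by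
  have := Real.pi_pos
  have : (0 : ℝ) < n := by exact_mod_cast (by omega : 0 < n)
  positivity

theorem two_pi_div_lt {n : ℕ} (hn : 3 ≤ n) : 2 * Real.pi / n < Real.pi := by
  have hp := Real.pi_pos
  have : (3 : ℝ) ≤ n := by exact_mod_cast hn
  rw [div_lt_iff₀ (by linarith)]
  nlinarith

theorem lt_of_two_pi_div_add_lt {a b c : ℕ} (ha : 3 ≤ a) (hb : 3 ≤ b) (hc : 3 ≤ c)
    (h : 2 * Real.pi / b + 2 * Real.pi / c < Real.pi + 2 * Real.pi / a) :
    2 * (a * (b + c)) < b * c * (a + 2) := by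
  have hp := Real.pi_pos
  have a0 : (0 : ℝ) < a := by exact_mod_cast (by omega : 0 < a)
  have b0 : (0 : ℝ) < b := by exact_mod_cast (by omega : 0 < b)
  have c0 : (0 : ℝ) < c := by exact_mod_cast (by omega : 0 < c)
  have : (2 * (a * (b + c)) : ℝ) < b * c * (a + 2) := by
    have h' := mul_lt_mul_of_pos_right h (by positivity : 0 < a * b * c / Real.pi)
    field_simp at h'
    linarith
  exact_mod_cast this

theorem lt_of_lt_two_pi_div_add {a b c : ℕ} (ha : 3 ≤ a) (hb : 3 ≤ b) (hc : 3 ≤ c)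
    (h : Real.pi < 2 * Real.pi / a + 2 * Real.pi / b + 2 * Real.pi / c) :
    a * b * c < 2 * (a * (b + c) + b * c) := by
  have hp := Real.pi_pos
  have a0 : (0 : ℝ) < a := by exact_mod_cast (by omega : 0 < a)
  have b0 : (0 : ℝ) < b := by exact_mod_cast (by omega : 0 < b)
  have c0 : (0 : ℝ) < c := by exact_mod_cast (by omega : 0 < c)
  have : (a * b * c : ℝ) < 2 * (a * (b + c) + b * c) := by
    have h' := mul_lt_mul_of_pos_right h (by positivity : 0 < a * b * c / Real.pi)
    field_simp at h'
    linarith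
  exact_mod_cast this

theorem triangleOK_of_minor_pos {a b c : ℕ} (ha : 3 ≤ a) (hb : 3 ≤ b) (hc : 3 ≤ c)
    (h : 0 < minor (Real.cos (2 * Real.pi / a)) (Real.cos (2 * Real.pi / b))
      (Real.cos (2 * Real.pi / c))) : triangleOK a b c := by
  have a0 := two_pi_div_pos ha
  have b0 := two_pi_div_pos hb
  have c0 := two_pi_div_pos hc
  have a1 := two_pi_div_lt ha
  have b1 := two_pi_div_lt hb
  have c1 := two_pi_div_lt hc
  have h' := h
  rw [minor_rotate] at h'
  have h'' := h'
  rw [minor_rotate] at h''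
  rw [triangleOK_iff]
  refine ⟨⟨⟨?_, ?_⟩, ?_⟩, ?_⟩
  · exact lt_of_lt_two_pi_div_add ha hb hc (pi_lt_add_of_minor_pos a0 b0 c0 a1 b1 c1 h)
  · exact lt_of_two_pi_div_add_lt ha hb hc (add_lt_of_minor_pos a0 b1 c1 h)
  · have := lt_of_two_pi_div_add_lt hb hc ha (add_lt_of_minor_pos b0 c1 a1 h')
    linarith
  · have := lt_of_two_pi_div_add_lt hc ha hb (add_lt_of_minor_pos c0 a1 b1 h'')
    linarith

/-! ### Edges with small dihedral angles -/

/-- The triangle inequalities give `|1/a + 1/b - 1/2| < 1/c ≤ 1/42`, and the closest miss is `1/3 +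
1/7 = 1/2 - 1/42`, so 42 is just enough to force `1/a + 1/b = 1/2`. -/
theorem eq_or_eq_of_triangleOK {a b c : ℕ} (ha : 3 ≤ a) (hb : 3 ≤ b) (hc : 42 ≤ c)
    (h : triangleOK a b c) : a = 3 ∧ b = 6 ∨ a = 4 ∧ b = 4 ∨ a = 6 ∧ b = 3 := by
  rw [triangleOK_iff] at h
  obtain ⟨⟨⟨h1, -⟩, -⟩, h2⟩ := h
  have key : ∀ x y : ℕ, 3 ≤ x → x ≤ y → x * y * c < 2 * (x * (y + c) + y * c) →
      2 * (c * (x + y)) < x * y * (c + 2) → x = 3 ∧ y = 6 ∨ x = 4 ∧ y = 4 := by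
    intro x y hx hxy h1 h2
    have hx4 : x ≤ 4 := by
      by_contra! hx5
      obtain ⟨u, rfl⟩ := Nat.exists_eq_add_of_le hx5
      obtain ⟨v, rfl⟩ := Nat.exists_eq_add_of_le hxy
      obtain ⟨w, rfl⟩ := Nat.exists_eq_add_of_le hc
      nlinarith [Nat.zero_le (u * v), Nat.zero_le (u * w), Nat.zero_le (v * w),
        Nat.zero_le (u * v * w), Nat.zero_le (u * u), Nat.zero_le (u * u * w)]
    interval_cases x
    · have : y < 7 := by
        by_contra! hy
        obtain ⟨v, rfl⟩ := Nat.exists_eq_add_of_le hy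
        obtain ⟨w, rfl⟩ := Nat.exists_eq_add_of_le hc
        nlinarith [Nat.zero_le (v * w)]
      interval_cases y <;> omega
    · have : y < 5 := by
        by_contra! hy
        obtain ⟨v, rfl⟩ := Nat.exists_eq_add_of_le hy
        obtain ⟨w, rfl⟩ := Nat.exists_eq_add_of_le hc
        nlinarith [Nat.zero_le (v * w)]
      omega
  rcases le_total a b with hab | hab
  · have := key a b ha hab h1 h2
    omega
  · have := key b a hb hab (by linarith) (by linarith)
    omega

theorem cos_two_pi_div_three : Real.cos (2 * Real.pi / (3 : ℕ)) = -1 / 2 := by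
  rw [show 2 * Real.pi / (3 : ℕ) = Real.pi - Real.pi / 3 by push_cast; ring, Real.cos_pi_sub,
    Real.cos_pi_div_three]; ring

theorem cos_two_pi_div_four : Real.cos (2 * Real.pi / (4 : ℕ)) = 0 := by
  rw [show 2 * Real.pi / (4 : ℕ) = Real.pi / 2 by push_cast; ring, Real.cos_pi_div_two]

theorem cos_two_pi_div_six : Real.cos (2 * Real.pi / (6 : ℕ)) = 1 / 2 := by
  rw [show 2 * Real.pi / (6 : ℕ) = Real.pi / 3 by push_cast; ring, Real.cos_pi_div_three]

theorem cos_two_pi_div_mono {m n : ℕ} (hm : 3 ≤ m) (h : m ≤ n) :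
    Real.cos (2 * Real.pi / m) ≤ Real.cos (2 * Real.pi / n) := by
  have hm' : (0 : ℝ) < m := by exact_mod_cast (by omega : 0 < m)
  have : (m : ℝ) ≤ n := by exact_mod_cast h
  have hp := Real.pi_pos
  exact Real.cos_le_cos_of_nonneg_of_le_pi (two_pi_div_pos (hm.trans h)).le (two_pi_div_lt hm).le
    (by gcongr)

theorem cos_two_pi_div_lt_one {n : ℕ} (hn : 3 ≤ n) : Real.cos (2 * Real.pi / n) < 1 := by
  have := Real.cos_lt_cos_of_nonneg_of_le_pi le_rfl (two_pi_div_lt hn).le (two_pi_div_pos hn)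
  rwa [Real.cos_zero] at this

theorem cos_two_pi_div_gt {n : ℕ} (hn : 42 ≤ n) : 49 / 50 < Real.cos (2 * Real.pi / n) := by
  have h := Real.one_sub_sq_div_two_le_cos (x := 2 * Real.pi / n)
  have h0 := two_pi_div_pos (n := n) (by omega)
  have h1 : 2 * Real.pi / n ≤ 3 / 20 := by
    have : (42 : ℝ) ≤ n := by exact_mod_cast hn
    rw [div_le_iff₀ (by linarith)]
    have := Real.pi_lt_d2
    norm_num at this
    linarith
  nlinarith

/-- In this and the next two lemmas, `A` is the cosine at the edge with small angle, `B` that at the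
opposite edge, and the expression is `normalDet` when the other four cosines are 0 or ±1/2. -/
theorem det_ne_zero_of_opposite {A B : ℝ} (hA : 49 / 50 < A) (hA' : A < 1) (hB : -1 / 2 ≤ B)
    (hB' : B ≤ 2 / 5) : (1 - A) * (1 + B) * ((1 + A) * (1 - B) - 1) ≠ 0 := by
  refine (mul_pos (mul_pos (by linarith) (by linarith)) ?_).ne'
  nlinarith

theorem det_ne_zero_of_mixed {A B : ℝ} (hA : 49 / 50 < A) (hA' : A < 1) (hB : -1 / 2 ≤ B)
    (hB' : B ≤ 17 / 20) : (1 - A) * ((1 + A) * (1 - B ^ 2) - 1 / 2) ≠ 0 := by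
  refine (mul_pos (by linarith) ?_).ne'
  have : B ^ 2 ≤ (17 / 20) ^ 2 := by nlinarith
  nlinarith

theorem det_ne_zero_of_alternating {A B : ℝ} (hA : 49 / 50 < A) (hA' : A < 1) (hB : B < 1)
    (hB' : 0 ≤ B ∨ B = -1 / 2) : (1 - A) * (1 - B) * ((1 + A) * (1 + B) - 1) ≠ 0 := by
  refine mul_ne_zero (mul_pos (by linarith) (by linarith)).ne' ?_
  rcases hB' with h | h
  · have : 0 < (1 + A) * (1 + B) - 1 := by nlinarith
    exact this.ne'
  · rw [h]; intro h'; linarith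

theorem small_of_normalDet_eq_zero {n : Fin 6 → ℕ} (hn : ∀ e, 3 ≤ n e) {c : Fin 6 → ℝ}
    (hc : ∀ e, c e = Real.cos (2 * Real.pi / n e))
    (t0 : triangleOK (n 0) (n 1) (n 2))
    (t2 : triangleOK (n 1) (n 3) (n 5)) (t3 : triangleOK (n 2) (n 4) (n 5))
    (hdet : normalDet c = 0) : n 5 ≤ 41 := by
  by_contra! h5
  have p2 := eq_or_eq_of_triangleOK (hn 1) (hn 3) h5 t2
  have p3 := eq_or_eq_of_triangleOK (hn 2) (hn 4) h5 t3
  have l5 := cos_two_pi_div_gt h5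
  have u5 := cos_two_pi_div_lt_one (hn 5)
  have u0 := cos_two_pi_div_lt_one (hn 0)
  have l0 := cos_two_pi_div_mono le_rfl (hn 0)
  have b11 : n 0 ≤ 11 → Real.cos (2 * Real.pi / n 0) ≤ 17 / 20 := fun h => by
    have h1 := cos_two_pi_div_mono (hn 0) h
    have h2 := abs_le.1 (abs_cos_sub_cosTable_le (p := (11, 8412535328)) (by decide))
    norm_num at h1 h2 ⊢
    linarith
  have b5 : n 0 ≤ 5 → Real.cos (2 * Real.pi / n 0) ≤ 2 / 5 := fun h => by
    have h1 := cos_two_pi_div_mono (hn 0) h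
    have h2 := abs_le.1 (abs_cos_sub_cosTable_le (p := (5, 3090169944)) (by decide))
    norm_num at h1 h2 ⊢
    linarith
  have b4 : 0 ≤ Real.cos (2 * Real.pi / n 0) ∨ Real.cos (2 * Real.pi / n 0) = -1 / 2 := by
    rcases (hn 0).eq_or_lt with h | h
    · exact Or.inr (h ▸ cos_two_pi_div_three)
    · exact Or.inl (cos_two_pi_div_four ▸ cos_two_pi_div_mono (by norm_num) h)
  rw [cos_two_pi_div_three] at l0
  simp only [← hc] at l5 u5 u0 l0 b11 b5 b4
  rw [triangleOK_iff] at t0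
  have c1 := hc 1
  have c2 := hc 2
  have c3 := hc 3
  have c4 := hc 4
  simp only [normalDet, minor, cof1, cof2, cof3] at hdet
  -- In all nine cases `c 3 = -c 1` and `c 4 = -c 2`. The triangle at the first vertex bounds `n 0`
  -- by 5 when `n 1 = n 2` is 3 or 6, and by 11 when exactly one of `n 1`, `n 2` is 4.
  rcases p2 with ⟨e1, e3⟩ | ⟨e1, e3⟩ | ⟨e1, e3⟩ <;>
  rcases p3 with ⟨e2, e4⟩ | ⟨e2, e4⟩ | ⟨e2, e4⟩ <;>
  simp only [e1, e2, e3, e4, cos_two_pi_div_three, cos_two_pi_div_four, cos_two_pi_div_six]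
    at t0 c1 c2 c3 c4 <;>
  rw [c1, c2, c3, c4] at hdet
  · exact det_ne_zero_of_opposite l5 u5 l0 (b5 (by omega)) (by linear_combination hdet)
  · exact det_ne_zero_of_mixed l5 u5 l0 (b11 (by omega)) (by linear_combination hdet)
  · exact det_ne_zero_of_alternating l5 u5 u0 b4 (by linear_combination hdet)
  · exact det_ne_zero_of_mixed l5 u5 l0 (b11 (by omega)) (by linear_combination hdet)
  · have : 0 < (1 - c 5) * (1 + c 5) * ((1 - c 0) * (1 + c 0)) :=
      mul_pos (mul_pos (by linarith) (by linarith)) (mul_pos (by linarith) (by linarith))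
    linarith
  · exact det_ne_zero_of_mixed l5 u5 l0 (b11 (by omega)) (by linear_combination hdet)
  · exact det_ne_zero_of_alternating l5 u5 u0 b4 (by linear_combination hdet)
  · exact det_ne_zero_of_mixed l5 u5 l0 (b11 (by omega)) (by linear_combination hdet)
  · exact det_ne_zero_of_opposite l5 u5 l0 (b5 (by omega)) (by linear_combination hdet)

/-! ### The classification -/

/-- `minor (-1) y z = -(y - z) ^ 2`. This excludes the angle π, that is, `n = 2`. -/
theorem minor_pos_ne {x y z : ℝ} (h : 0 < minor x y z) : x ≠ -1 ∧ y ≠ -1 ∧ z ≠ -1 := by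
  rw [minor] at h
  refine ⟨?_, ?_, ?_⟩ <;> rintro rfl
  · nlinarith [sq_nonneg (y - z)]
  · nlinarith [sq_nonneg (x - z)]
  · nlinarith [sq_nonneg (x - y)]

theorem dihedralAngles_nonneg (T : Tetrahedron) (e : Fin 6) : 0 ≤ dihedralAngles T e := by
  rw [dihedralAngles_eq]; exact angle_nonneg _ _

theorem dihedralAngles_le_pi (T : Tetrahedron) (e : Fin 6) : dihedralAngles T e ≤ Real.pi := by
  rw [dihedralAngles_eq]; exact angle_le_pi _ _

theorem three_le_of_dihedralAngles {T : Tetrahedron} {n : Fin 6 → ℕ} (h0 : ∀ e, 0 < n e)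
    (h : ∀ e, dihedralAngles T e = 2 * Real.pi / n e) (e : Fin 6) : 3 ≤ n e := by
  have hp := Real.pi_pos
  by_contra! hlt
  have h1 : n e ≠ 1 := fun h1 => by
    have := dihedralAngles_le_pi T e
    rw [h, h1] at this
    norm_num at this
    linarith
  have h2 : n e = 2 := by have := h0 e; omega
  have hcos : Real.cos (dihedralAngles T e) = -1 := by
    rw [h, h2, Nat.cast_two, mul_div_cancel_left₀ _ two_ne_zero, Real.cos_pi]
  obtain ⟨a, ha, -⟩ := exists_isAreaVector T
  have m0 := minor_pos_ne ha.minor0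
  have m1 := minor_pos_ne ha.minor1
  have m2 := minor_pos_ne ha.minor2
  fin_cases e
  exacts [m0.1 hcos, m0.2.1 hcos, m0.2.2 hcos, m1.2.1 hcos, m1.2.2 hcos, m2.2.2 hcos]

/-- `T` has dihedral angles `2π / n e`. -/
def HasAngles (T : Tetrahedron) (n : Fin 6 → ℕ) : Prop :=
  (∀ e, 0 < n e) ∧ ∀ e, dihedralAngles T e = 2 * Real.pi / n e

theorem HasAngles.reindex {T : Tetrahedron} {n : Fin 6 → ℕ} (h : HasAngles T n)
    (σ : Equiv.Perm (Fin 4)) : HasAngles (T.reindex σ.symm) (fun e => n (edgeMap σ e)) :=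
  ⟨fun e => h.1 _, fun e => by rw [dihedralAngles_reindex, h.2, Equiv.symm_symm]⟩

theorem HasAngles.necessary {T : Tetrahedron} {n : Fin 6 → ℕ} (h : HasAngles T n) :
    (∀ e, 3 ≤ n e) ∧ triangleOK (n 0) (n 1) (n 2) ∧ triangleOK (n 0) (n 3) (n 4) ∧
    triangleOK (n 1) (n 3) (n 5) ∧ triangleOK (n 2) (n 4) (n 5) ∧
    ∃ c : Fin 6 → ℝ, (∀ e, c e = Real.cos (2 * Real.pi / n e)) ∧
      0 < cof1 c ∧ 0 < cof2 c ∧ 0 < cof3 c ∧ normalDet c = 0 := by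
  have h3 := three_le_of_dihedralAngles h.1 h.2
  obtain ⟨a, ha, -⟩ := exists_isAreaVector T
  simp only [h.2] at ha
  exact ⟨h3, triangleOK_of_minor_pos (h3 0) (h3 1) (h3 2) ha.minor0,
    triangleOK_of_minor_pos (h3 0) (h3 3) (h3 4) ha.minor1,
    triangleOK_of_minor_pos (h3 1) (h3 3) (h3 5) ha.minor2,
    triangleOK_of_minor_pos (h3 2) (h3 4) (h3 5) ha.minor3,
    _, fun _ => rfl, ha.cof_pos.1, ha.cof_pos.2.1, ha.cof_pos.2.2, ha.normalDet_eq_zero⟩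

theorem exists_edgeMap_five : ∀ e : Fin 6, ∃ σ : Equiv.Perm (Fin 4), edgeMap σ 5 = e := by
  decide +kernel

theorem HasAngles.le {T : Tetrahedron} {n : Fin 6 → ℕ} (h : HasAngles T n) (e : Fin 6) :
    n e ≤ 41 := by
  obtain ⟨σ, rfl⟩ := exists_edgeMap_five e
  obtain ⟨h3, t0, -, t2, t3, c, hc, -, -, -, hdet⟩ := (h.reindex σ).necessary
  exact small_of_normalDet_eq_zero h3 hc t0 t2 t3 hdet

/-- In the chosen numbering `e.rev` is the edge opposite to `e`; vertex permutations act
transitively on ordered pairs of distinct edges with a common vertex. -/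
theorem exists_edgeMap_flag : ∀ e e' : Fin 6, e' ≠ e → e' ≠ e.rev →
    ∃ σ : Equiv.Perm (Fin 4), edgeMap σ 0 = e ∧ edgeMap σ 1 = e' := by
  decide +kernel

theorem edgeMap_adjacent : ∀ (σ : Equiv.Perm (Fin 4)) (k : Fin 6), k ≠ 0 → k ≠ 5 →
    edgeMap σ k ≠ edgeMap σ 0 ∧ edgeMap σ k ≠ (edgeMap σ 0).rev := by
  decide +kernel

theorem exists_sorted (n : Fin 6 → ℕ) : ∃ σ : Equiv.Perm (Fin 4),
    (∀ e, n (edgeMap σ e) ≤ n (edgeMap σ 0)) ∧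
    ∀ e, e ≠ 0 → e ≠ 5 → n (edgeMap σ e) ≤ n (edgeMap σ 1) := by
  obtain ⟨e, he⟩ := Finite.exists_max n
  obtain ⟨e', he', hmax⟩ := (Finset.univ.filter fun k : Fin 6 => k ≠ e ∧ k ≠ e.rev).exists_max_image
    n ((by decide : ∀ e : Fin 6, (Finset.univ.filter fun k : Fin 6 => k ≠ e ∧ k ≠ e.rev).Nonempty) e)
  rw [Finset.mem_filter] at he'
  obtain ⟨σ, rfl, rfl⟩ := exists_edgeMap_flag e e' he'.2.1 he'.2.2
  exact ⟨σ, fun _ => he _, fun k h0 h5 => hmax _ (by simpa using edgeMap_adjacent σ k h0 h5)⟩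

theorem HasAngles.exists_hasRow {T : Tetrahedron} {n : Fin 6 → ℕ} (h : HasAngles T n) :
    ∃ r : Fin 11, ∃ σ : Equiv.Perm (Fin 4), HasRow (T.reindex σ) r := by
  obtain ⟨σ, hs0, hs1⟩ := exists_sorted n
  have hT := h.reindex σ
  obtain ⟨h3, t0, t1, t2, t3, c, hc, k1, k2, k3, hdet⟩ := hT.necessary
  have hmem := mem_survivors h3 hT.le hc t0 t1 t2 t3 k1 k2 k3 hdet (hs0 1) (hs0 5)
    (hs1 2 (by decide) (by decide)) (hs1 3 (by decide) (by decide)) (hs1 4 (by decide) (by decide))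
  obtain ⟨r, ρ, hr⟩ := survivors_row _ hmem
  refine ⟨r, σ.symm.trans ρ.symm, fun e => ?_⟩
  rw [Affine.Simplex.reindex_trans, (hT.reindex ρ).2, ← hr]

theorem table_pos : ∀ r e, 3 ≤ table r e := by decide

theorem HasAngles.sum_table {T : Tetrahedron} {n : Fin 6 → ℕ} (h : HasAngles T n) {r : Fin 11}
    {σ : Equiv.Perm (Fin 4)} (hr : HasRow (T.reindex σ) r) :
    ∑ e, table r e ^ 3 = ∑ e, n e ^ 3 := by
  have key : ∀ e, table r e = n (edgeMap σ.symm e) := fun e => by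
    have h1 := hr e
    rw [dihedralAngles_reindex, h.2] at h1
    have hn : (0 : ℝ) < n (edgeMap σ.symm e) := by exact_mod_cast h.1 _
    have ht : (0 : ℝ) < table r e := by
      exact_mod_cast (by have := table_pos r e; omega : 0 < table r e)
    have := Real.pi_pos
    rw [div_eq_div_iff hn.ne' ht.ne'] at h1
    exact_mod_cast mul_left_cancel₀ (by positivity : 2 * Real.pi ≠ 0) h1
  simp only [key]
  exact (edgeMap_bijective σ.symm).sum_comp (fun e => n e ^ 3)

theorem exists_angle_of_hasRow {T : Tetrahedron} {r : Fin 11} {σ : Equiv.Perm (Fin 4)}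
    (hr : HasRow (T.reindex σ) r) (e : Fin 6) :
    ∃ n : ℕ, 0 < n ∧ dihedralAngles T e = 2 * Real.pi / n := by
  obtain ⟨e', rfl⟩ := (edgeMap_bijective σ.symm).2 e
  exact ⟨table r e', by have := table_pos r e'; omega, by rw [← dihedralAngles_reindex]; exact hr e'⟩

/-! ### Realization of the table -/

theorem cos_two_pi_div_five : Real.cos (2 * Real.pi / (5 : ℕ)) = (√5 - 1) / 4 := by
  rw [show 2 * Real.pi / (5 : ℕ) = 2 * (Real.pi / 5) by push_cast; ring, Real.cos_two_mul,
    Real.cos_pi_div_five]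
  have := Real.sq_sqrt (show (0 : ℝ) ≤ 5 by norm_num)
  linear_combination this / 8

theorem cos_two_pi_div_eight : Real.cos (2 * Real.pi / (8 : ℕ)) = √2 / 2 := by
  rw [show 2 * Real.pi / (8 : ℕ) = Real.pi / 4 by push_cast; ring, Real.cos_pi_div_four]

theorem cos_two_pi_div_ten : Real.cos (2 * Real.pi / (10 : ℕ)) = (1 + √5) / 4 := by
  rw [show 2 * Real.pi / (10 : ℕ) = Real.pi / 5 by push_cast; ring, Real.cos_pi_div_five]

/-- The criterion of `exists_tetrahedron` gives the cosines, and injectivity of the cosine on `[0,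
π]` gives the angles. -/
theorem exists_hasRow_of_cos {r : Fin 11} (c : Fin 6 → ℝ)
    (hc : ∀ e, c e = Real.cos (2 * Real.pi / table r e))
    (h : 0 < minor (c 0) (c 1) (c 2) ∧ 0 < cof1 c ∧ 0 < cof2 c ∧ 0 < cof3 c ∧ normalDet c = 0) :
    ∃ T : Tetrahedron, HasRow T r := by
  have h3 := table_pos r
  have hc0 : c 0 ^ 2 < 1 := by
    have h1 := cos_two_pi_div_lt_one (h3 0)
    have h2 := cos_two_pi_div_mono le_rfl (h3 0)
    rw [cos_two_pi_div_three, ← hc] at h2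
    rw [← hc] at h1
    nlinarith
  obtain ⟨T, hT⟩ := exists_tetrahedron hc0 h.1 h.2.1 h.2.2.1 h.2.2.2.1 h.2.2.2.2
  refine ⟨T, fun e => Real.injOn_cos ⟨dihedralAngles_nonneg T e, dihedralAngles_le_pi T e⟩
    ⟨(two_pi_div_pos (h3 e)).le, (two_pi_div_lt (h3 e)).le⟩ ((hT e).trans (hc e))⟩

theorem exists_hasRow (r : Fin 11) : ∃ T : Tetrahedron, HasRow T r := by
  -- Only `√2` and `√5` occur in the cosines of the table. Reducing their powers makes every
  -- condition linear in them, and these rational bounds decide the signs.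
  have a2 : √2 ^ 2 = (2 : ℝ) := Real.sq_sqrt (by norm_num)
  have a3 : √2 ^ 3 = (2 : ℝ) * √2 := by rw [pow_succ, a2]
  have a4 : √2 ^ 4 = (4 : ℝ) := by rw [show √2 ^ 4 = (√2 ^ 2) ^ 2 by ring, a2]; norm_num
  have al : (7 : ℝ) / 5 < √2 := Real.lt_sqrt_of_sq_lt (by norm_num)
  have au : √2 < (3 : ℝ) / 2 := (Real.sqrt_lt' (by norm_num)).2 (by norm_num)
  have b2 : √5 ^ 2 = (5 : ℝ) := Real.sq_sqrt (by norm_num)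
  have b3 : √5 ^ 3 = (5 : ℝ) * √5 := by rw [pow_succ, b2]
  have b4 : √5 ^ 4 = (25 : ℝ) := by rw [show √5 ^ 4 = (√5 ^ 2) ^ 2 by ring, b2]; norm_num
  have bl : (11 : ℝ) / 5 < √5 := Real.lt_sqrt_of_sq_lt (by norm_num)
  have bu : √5 < (9 : ℝ) / 4 := (Real.sqrt_lt' (by norm_num)).2 (by norm_num)
  fin_cases r
  · refine exists_hasRow_of_cos ![-1 / 2, 1 / 2, 1 / 2, √2 / 2, √2 / 2, 0] (fun e => by
      fin_cases e
      exacts [cos_two_pi_div_three.symm, cos_two_pi_div_six.symm, cos_two_pi_div_six.symm,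
          cos_two_pi_div_eight.symm, cos_two_pi_div_eight.symm, cos_two_pi_div_four.symm]) ?_
    simp only [normalDet, minor, cof1, cof2, cof3, Matrix.cons_val]
    refine ⟨?_, ?_, ?_, ?_, ?_⟩ <;> ring_nf <;> (try simp only [a2]) <;> linarith
  · refine exists_hasRow_of_cos ![0, 0, 0, 1 / 2, 1 / 2, √2 / 2] (fun e => by
      fin_cases e
      exacts [cos_two_pi_div_four.symm, cos_two_pi_div_four.symm, cos_two_pi_div_four.symm,
          cos_two_pi_div_six.symm, cos_two_pi_div_six.symm, cos_two_pi_div_eight.symm]) ?_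
    simp only [normalDet, minor, cof1, cof2, cof3, Matrix.cons_val]
    refine ⟨?_, ?_, ?_, ?_, ?_⟩ <;> ring_nf <;> (try simp only [a2]) <;> linarith
  · refine exists_hasRow_of_cos ![0, 0, √2 / 2, √2 / 2, 0, 1 / 2] (fun e => by
      fin_cases e
      exacts [cos_two_pi_div_four.symm, cos_two_pi_div_four.symm, cos_two_pi_div_eight.symm,
          cos_two_pi_div_eight.symm, cos_two_pi_div_four.symm, cos_two_pi_div_six.symm]) ?_
    simp only [normalDet, minor, cof1, cof2, cof3, Matrix.cons_val]
    refine ⟨?_, ?_, ?_, ?_, ?_⟩ <;> ring_nf <;> (try simp only [a2, a3, a4]) <;> linarith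
  · refine exists_hasRow_of_cos ![0, (√5 - 1) / 4, 1 / 2, (1 + √5) / 4, (√5 - 1) / 4, 0] (fun e => by
      fin_cases e
      exacts [cos_two_pi_div_four.symm, cos_two_pi_div_five.symm, cos_two_pi_div_six.symm,
          cos_two_pi_div_ten.symm, cos_two_pi_div_five.symm, cos_two_pi_div_four.symm]) ?_
    simp only [normalDet, minor, cof1, cof2, cof3, Matrix.cons_val]
    refine ⟨?_, ?_, ?_, ?_, ?_⟩ <;> ring_nf <;> (try simp only [b2, b3, b4]) <;> linarith
  · refine exists_hasRow_of_cos ![0, 1 / 2, 1 / 2, 1 / 2, 1 / 2, 0] (fun e => by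
      fin_cases e
      exacts [cos_two_pi_div_four.symm, cos_two_pi_div_six.symm, cos_two_pi_div_six.symm,
          cos_two_pi_div_six.symm, cos_two_pi_div_six.symm, cos_two_pi_div_four.symm]) ?_
    simp only [normalDet, minor, cof1, cof2, cof3, Matrix.cons_val]
    refine ⟨?_, ?_, ?_, ?_, ?_⟩ <;> ring_nf <;> linarith
  · refine exists_hasRow_of_cos ![-1 / 2, 0, (√5 - 1) / 4, (1 + √5) / 4, 1 / 2, 1 / 2] (fun e => by
      fin_cases e
      exacts [cos_two_pi_div_three.symm, cos_two_pi_div_four.symm, cos_two_pi_div_five.symm,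
          cos_two_pi_div_ten.symm, cos_two_pi_div_six.symm, cos_two_pi_div_six.symm]) ?_
    simp only [normalDet, minor, cof1, cof2, cof3, Matrix.cons_val]
    refine ⟨?_, ?_, ?_, ?_, ?_⟩ <;> ring_nf <;> (try simp only [b2, b3, b4]) <;> linarith
  · refine exists_hasRow_of_cos ![-1 / 2, (√5 - 1) / 4, (√5 - 1) / 4, (1 + √5) / 4, (1 + √5) / 4, 0] (fun e => by
      fin_cases e
      exacts [cos_two_pi_div_three.symm, cos_two_pi_div_five.symm, cos_two_pi_div_five.symm,
          cos_two_pi_div_ten.symm, cos_two_pi_div_ten.symm, cos_two_pi_div_four.symm]) ?_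
    simp only [normalDet, minor, cof1, cof2, cof3, Matrix.cons_val]
    refine ⟨?_, ?_, ?_, ?_, ?_⟩ <;> ring_nf <;> (try simp only [b2]) <;> linarith
  · refine exists_hasRow_of_cos ![-1 / 2, (√5 - 1) / 4, (1 + √5) / 4, (1 + √5) / 4, 1 / 2, 0] (fun e => by
      fin_cases e
      exacts [cos_two_pi_div_three.symm, cos_two_pi_div_five.symm, cos_two_pi_div_ten.symm,
          cos_two_pi_div_ten.symm, cos_two_pi_div_six.symm, cos_two_pi_div_four.symm]) ?_
    simp only [normalDet, minor, cof1, cof2, cof3, Matrix.cons_val]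
    refine ⟨?_, ?_, ?_, ?_, ?_⟩ <;> ring_nf <;> (try simp only [b2, b3, b4]) <;> linarith
  · refine exists_hasRow_of_cos ![-1 / 2, 1 / 2, (1 + √5) / 4, (1 + √5) / 4, (1 + √5) / 4, -1 / 2] (fun e => by
      fin_cases e
      exacts [cos_two_pi_div_three.symm, cos_two_pi_div_six.symm, cos_two_pi_div_ten.symm,
          cos_two_pi_div_ten.symm, cos_two_pi_div_ten.symm, cos_two_pi_div_three.symm]) ?_
    simp only [normalDet, minor, cof1, cof2, cof3, Matrix.cons_val]
    refine ⟨?_, ?_, ?_, ?_, ?_⟩ <;> ring_nf <;> (try simp only [b2, b3, b4]) <;> linarith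
  · refine exists_hasRow_of_cos ![0, 0, 0, (√5 - 1) / 4, 1 / 2, (1 + √5) / 4] (fun e => by
      fin_cases e
      exacts [cos_two_pi_div_four.symm, cos_two_pi_div_four.symm, cos_two_pi_div_four.symm,
          cos_two_pi_div_five.symm, cos_two_pi_div_six.symm, cos_two_pi_div_ten.symm]) ?_
    simp only [normalDet, minor, cof1, cof2, cof3, Matrix.cons_val]
    refine ⟨?_, ?_, ?_, ?_, ?_⟩ <;> ring_nf <;> (try simp only [b2]) <;> linarith
  · refine exists_hasRow_of_cos ![0, (√5 - 1) / 4, 1 / 2, (√5 - 1) / 4, 1 / 2, (√5 - 1) / 4] (fun e => by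
      fin_cases e
      exacts [cos_two_pi_div_four.symm, cos_two_pi_div_five.symm, cos_two_pi_div_six.symm,
          cos_two_pi_div_five.symm, cos_two_pi_div_six.symm, cos_two_pi_div_five.symm]) ?_
    simp only [normalDet, minor, cof1, cof2, cof3, Matrix.cons_val]
    refine ⟨?_, ?_, ?_, ?_, ?_⟩ <;> ring_nf <;> (try simp only [b2, b3]) <;> linarith

end TwoPiTetrahedra

end

/-! ### The main theorem -/

theorem theorem4p6 :
    -- every row of the table is realized by a tetrahedron
    (∀ r : Fin 11, ∃ T : TwoPiTetrahedra.Tetrahedron, TwoPiTetrahedra.HasRow T r) ∧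
    -- which the row determines up to similarity
    (∀ (r : Fin 11) (T T' : TwoPiTetrahedra.Tetrahedron),
      TwoPiTetrahedra.HasRow T r → TwoPiTetrahedra.HasRow T' r →
        Similar T.points T'.points) ∧
    -- the tetrahedra all of whose dihedral angles have the form `2π / n` are exactly those of
    -- the table, up to a permutation of the vertices, and each belongs to just one row
    (∀ T : TwoPiTetrahedra.Tetrahedron,
      (∀ e : Fin 6, ∃ n : ℕ, 0 < n ∧
        TwoPiTetrahedra.dihedralAngles T e = 2 * Real.pi / (n : ℝ)) ↔
      ∃! r : Fin 11, ∃ σ : Equiv.Perm (Fin 4), TwoPiTetrahedra.HasRow (T.reindex σ) r) := by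
  refine ⟨TwoPiTetrahedra.exists_hasRow, fun r T T' h h' =>
    TwoPiTetrahedra.similar_of_dihedralAngles_eq fun e => (h e).trans (h' e).symm,
    fun T => ⟨fun h => ?_, ?_⟩⟩
  · choose n hn using h
    have hT : TwoPiTetrahedra.HasAngles T n := ⟨fun e => (hn e).1, fun e => (hn e).2⟩
    obtain ⟨r, hr⟩ := hT.exists_hasRow
    refine ⟨r, hr, fun s ⟨τ, hs⟩ => ?_⟩
    obtain ⟨σ, hσ⟩ := hr
    exact TwoPiTetrahedra.eq_of_sum_pow_eq s r ((hT.sum_table hs).trans (hT.sum_table hσ).symm)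
  · rintro ⟨r, ⟨σ, hr⟩, -⟩
    exact TwoPiTetrahedra.exists_angle_of_hasRow hr
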